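/- Let $G$ and $H$ be locally finite simple graphs (finite or infinite) that are regular of degrees $d_G$ and $d_H$. For a vertex $x$ of degree $d_x\ge 1$ and $\alpha\in[0,1]$ let $\mu_x^\alpha$ be the probability measure on the vertices with mass $\alpha$ at $x$ and mass $(1-\alpha)/d_x$ at each neighbour of $x$. For adjacent vertices $x,y$ let $\kappa_\alpha(x,y)=1-W(\mu_x^\alpha,\mu_y^\alpha)/d(x,y)$ be the $\alpha$-Ollivier–Ricci curvature, where $d$ is the graph distance and $W$ is the $1$-Wasserstein distance with respect to $d$, and let $\kappa_{\mathrm{LLY}}(x,y)=\lim_{\alpha\to1^-}\kappa_\alpha(x,y)/(1-\alpha)$ be the Lin–Lu–Yau curvature. The strong product $G\boxtimes H$ is the graph on $V(G)\times V(H)$ in which two distinct vertices $(x,y)$ and $(x',y')$ are adjacent if and only if $x'\in N_G[x]$ and $y'\in N_H[y]$, where $N[v]=N(v)\cup\{v\}$ denotes the closed neighbourhood. Then $G\boxtimes H$ is regular of degree $d_{G\boxtimes H}=d_G+d_H+d_Gd_H$. Moreover, for all vertices $x_1,x_2$ of $G$ with $N_G[x_1]=N_G[x_2]$ (possibly $x_1=x_2$)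 and all adjacent vertices $y_1,y_2$ of $H$, the limits defining $\kappa_{\mathrm{LLY}}(y_1,y_2)$ and $\kappa_{\mathrm{LLY}}((x_1,y_1),(x_2,y_2))$ exist, and $$\kappa_{\mathrm{LLY}}((x_1,y_1),(x_2,y_2))=\frac{d_H(d_G+1)}{d_{G\boxtimes H}}\,\kappa_{\mathrm{LLY}}(y_1,y_2),$$ $$\kappa_0((x_1,y_1),(x_2,y_2))=\frac{d_Gd_H}{d_{G\boxtimes H}}\,\kappa_{\mathrm{LLY}}(y_1,y_2)+\frac{d_H}{d_{G\boxtimes H}}\,\kappa_0(y_1,y_2),$$ where the curvatures on the left are those of $G\boxtimes H$ and those on the right are those of $H$. -/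

import Mathlib

open scoped ENNReal Topology
open Filter

namespace RicciGraph

/-- The closed neighbourhood `N[x] = N(x) ∪ {x}`. -/
def closedNbhd {V : Type*} (G : SimpleGraph V) (x : V) : Set V :=
  insert x (G.neighborSet x)

/-- The strong product of two graphs: two distinct vertices `p` and `q` are adjacent iff
`q.1 ∈ N[p.1]` and `q.2 ∈ N[p.2]`. -/
def strongProd {V W : Type*} (G : SimpleGraph V) (H : SimpleGraph W) : SimpleGraph (V × W) where
  Adj p q := p ≠ q ∧ q.1 ∈ closedNbhd G p.1 ∧ q.2 ∈ closedNbhd H p.2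
  symm := ⟨by
    rintro p q ⟨h, h1, h2⟩
    refine ⟨h.symm, ?_, ?_⟩
    · rcases h1 with h1 | h1
      · exact Or.inl h1.symm
      · exact Or.inr (G.adj_symm h1)
    · rcases h2 with h2 | h2
      · exact Or.inl h2.symm
      · exact Or.inr (H.adj_symm h2)⟩
  loopless := ⟨fun _ h => h.1 rfl⟩

theorem finite_closedNbhd {V : Type*} (G : SimpleGraph V) [G.LocallyFinite] (x : V) :
    (closedNbhd G x).Finite :=
  (Set.toFinite (G.neighborSet x)).insert x

noncomputable instance strongProdLocallyFinite {V W : Type*} (G : SimpleGraph V)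
    (H : SimpleGraph W) [G.LocallyFinite] [H.LocallyFinite] : (strongProd G H).LocallyFinite :=
  fun p => Set.Finite.fintype
    (((finite_closedNbhd G p.1).prod (finite_closedNbhd H p.2)).subset
      (fun _ hq => ⟨hq.2.1, hq.2.2⟩))

open Classical in
/-- The measure `μ_x^α` with idleness `α`: mass `α` at `x` and mass `(1 - α) / d_x` at each
neighbour of `x`. -/
noncomputable def lazyMeasure {V : Type*} (G : SimpleGraph V) [G.LocallyFinite] (α : ℝ) (x y : V) :
    ℝ :=
  if y = x then α else if G.Adj x y then (1 - α) / (G.degree x : ℝ) else 0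

/-- `π : V × V → [0, 1]` is a transport plan from `μ₁` to `μ₂`. -/
def IsTransportPlan {V : Type*} (μ₁ μ₂ : V → ℝ) (π : V → V → ℝ) : Prop :=
  (∀ x y, π x y ∈ Set.Icc (0 : ℝ) 1) ∧ (∀ x, HasSum (fun y => π x y) (μ₁ x)) ∧
    (∀ y, HasSum (fun x => π x y) (μ₂ y))

/-- The cost of a plan with respect to the graph distance, which is `∞` between vertices in
different connected components. -/
noncomputable def transportCost {V : Type*} (G : SimpleGraph V) (π : V → V → ℝ) : ℝ≥0∞ :=
  ∑' x, ∑' y, (G.edist x y : ℝ≥0∞) * ENNReal.ofReal (π x y)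

/-- The Wasserstein distance. -/
noncomputable def wasserstein {V : Type*} (G : SimpleGraph V) (μ₁ μ₂ : V → ℝ) : ℝ≥0∞ :=
  ⨅ (π : V → V → ℝ) (_ : IsTransportPlan μ₁ μ₂ π), transportCost G π

/-- The `α`-Ricci curvature `κ_α(x, y) = 1 - W(μ_x^α, μ_y^α) / d(x, y)`, for distinct vertices
`x`, `y` in the same connected component. -/
noncomputable def ricciCurv {V : Type*} (G : SimpleGraph V) [G.LocallyFinite] (α : ℝ) (x y : V) :
    ℝ :=
  1 - (wasserstein G (lazyMeasure G α x) (lazyMeasure G α y)).toReal / (G.dist x y : ℝ)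

/-- `κ_LLY(x, y)` exists and equals `κ`, that is, `κ_α(x, y) / (1 - α) → κ` as `α → 1`
(within `[0, 1)`). -/
def HasLLYCurv {V : Type*} (G : SimpleGraph V) [G.LocallyFinite] (x y : V) (κ : ℝ) : Prop :=
  Tendsto (fun α : ℝ => ricciCurv G α x y / (1 - α)) (𝓝[<] 1) (𝓝 κ)

open Classical in
/-- The Lin–Lu–Yau curvature `κ_LLY(x, y)`, the limit of `κ_α(x, y) / (1 - α)` as `α → 1`
(with value `0` if there is no limit). -/
noncomputable def llyCurv {V : Type*} (G : SimpleGraph V) [G.LocallyFinite] (x y : V) : ℝ :=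
  if h : ∃ κ, HasLLYCurv G x y κ then h.choose else 0

end RicciGraph

/-! For an edge `xy` between vertices of degree d, let D(f) be the sum of f over N[x] minus its sum
over N[y], and let M(s) be the maximum of s(f x − f y) + D(f) over functions f that are 1-Lipschitz
on N[x] ∪ N[y]. Kantorovich duality (`isGreatest_wasserstein`) gives κ_α = 1 − (1 − α) M(s)/d with s
= αd/(1 − α) − 1. Idleness 0 is s = −1, and s → ∞ as α → 1.

Two facts describe M. A maximizer of D can be clamped so that it drops by exactly 1 along the edge
(`IsPotential.exists_drop_eq_one`), so M(s) = s + M(0) for s ≥ 0 and κ_LLY = 1 + (1 − M(0))/d.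
Integrality of optimal potentials yields one potential that is optimal at both s = 0 and s = −1
(`exists_common_maximizer`), so M is affine on [−1, 0].

Closed neighbourhoods in G ⊠ H are products, and those of (x₁, y₁) and (x₂, y₂) have the same first
factor. Pulling back from H, and averaging over that factor, gives M_{G⊠H}((d_G + 1)s) = (d_G + 1)
M_H(s) (`isGreatest_edgeValues_strongProd`). The value s = 0 yields the Lin–Lu–Yau formula. The
product parameter −1 comes from s = −1/(d_G + 1) in H, where affinity gives M_{G⊠H}(−1) = d_G M_H(0)
+ M_H(−1), hence the formula for κ_0. -/

namespace RicciGraph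

/-! ### Kantorovich duality on a finite set, by flows and Hahn–Banach -/

section FiniteTransport

variable {X : Type*} [Fintype X]

/-- The cost of a flow on a finite type. -/
def flowCost (c ρ : X → X → ℝ) : ℝ := ∑ x, ∑ y, c x y * ρ x y

/-- The divergence (outflow minus inflow) of a flow on a finite type. -/
def flowDiv (ρ : X → X → ℝ) (x : X) : ℝ := ∑ y, ρ x y - ∑ y, ρ y x

/-- Sending flow that passes through `z` along direct edges lowers the outflow of `z` to `μ z`
without raising the cost. -/
theorem exists_reroute_at (c : X → X → ℝ) (hc : ∀ x y, 0 ≤ c x y)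
    (htri : ∀ x y z, c x z ≤ c x y + c y z) {μ ν : X → ℝ} (hμ : ∀ x, 0 ≤ μ x) (hν : ∀ x, 0 ≤ ν x)
    (ρ : X → X → ℝ) (hρ : ∀ x y, 0 ≤ ρ x y) (hdiv : ∀ x, flowDiv ρ x = μ x - ν x) (z : X) :
    ∃ ρ' : X → X → ℝ, (∀ x y, 0 ≤ ρ' x y) ∧ (∀ x, flowDiv ρ' x = μ x - ν x) ∧
      flowCost c ρ' ≤ flowCost c ρ ∧ (∑ y, ρ' z y ≤ μ z) ∧
      ∀ x, ∑ y, ρ' x y ≤ ∑ y, ρ x y := by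
  classical
  -- A loop at `z` adds equally to inflow and outflow, so deleting it keeps the divergence and does
  -- not raise the cost.
  wlog hz : ρ z z = 0 generalizing ρ
  · have hrow : ∀ x, ∑ y, (ρ x y - if x = z ∧ y = z then ρ z z else 0) =
        ∑ y, ρ x y - if x = z then ρ z z else 0 := by
      intro x
      rw [Finset.sum_sub_distrib]
      by_cases hx : x = z <;> simp [hx]
    have hcol : ∀ x, ∑ y, (ρ y x - if y = z ∧ x = z then ρ z z else 0) =
        ∑ y, ρ y x - if x = z then ρ z z else 0 := by
      intro x
      rw [Finset.sum_sub_distrib]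
      by_cases hx : x = z <;> simp [hx]
    have hle : ∀ x y, (ρ x y - if x = z ∧ y = z then ρ z z else 0) ≤ ρ x y := by
      intro x y
      split_ifs
      · linarith [hρ z z]
      · linarith
    obtain ⟨ρ', h0, h1, h2, h3, h4⟩ :=
      this (fun x y => ρ x y - if x = z ∧ y = z then ρ z z else 0)
      (by
        intro x y
        split_ifs with h
        · rw [h.1, h.2, sub_self]
        · simpa using hρ x y)
      (by
        intro x
        rw [← hdiv x, flowDiv, hrow, hcol, flowDiv]
        ring)
      (by simp)
    refine ⟨ρ', h0, h1, h2.trans ?_, h3, fun x => (h4 x).trans ?_⟩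
    · exact Finset.sum_le_sum fun x _ => Finset.sum_le_sum fun y _ =>
        mul_le_mul_of_nonneg_left (hle x y) (hc x y)
    · exact Finset.sum_le_sum fun y _ => hle x y
  by_cases hO : ∑ y, ρ z y ≤ μ z
  · exact ⟨ρ, hρ, hdiv, le_rfl, hO, fun _ => le_rfl⟩
  push Not at hO
  obtain ⟨O, hOdef⟩ : ∃ O, ∑ y, ρ z y = O := ⟨_, rfl⟩
  obtain ⟨I, hIdef⟩ : ∃ I, ∑ x, ρ x z = I := ⟨_, rfl⟩
  have hOI : O - I = μ z - ν z := by rw [← hdiv z, flowDiv, hOdef, hIdef]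
  rw [hOdef] at hO
  have hOpos : 0 < O := (hμ z).trans_lt hO
  have hIpos : 0 < I := by linarith [hν z]
  -- For each pair of edges x → z → y, the amount l·ρ(x,z)·ρ(z,y) is sent directly x → y. The
  -- outflow of `z` then falls by l·O·I, which this `l` makes equal to the excess O − μ z.
  obtain ⟨l, hl⟩ : ∃ l, l = (O - μ z) / (O * I) := ⟨_, rfl⟩
  have hl0 : 0 ≤ l := by rw [hl]; exact div_nonneg (by linarith) (by positivity)
  have hlOI : l * O * I = O - μ z := by rw [hl]; field_simp
  have hlO : l * O ≤ 1 := by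
    have : l * O * I ≤ 1 * I := by rw [hlOI]; linarith [hν z]
    exact le_of_mul_le_mul_right this hIpos
  have hlI : l * I ≤ 1 := by
    have : l * I * O ≤ 1 * O := by
      rw [show l * I * O = l * O * I by ring, hlOI]; linarith [hμ z]
    exact le_of_mul_le_mul_right this hOpos
  have hrow : ∀ x, ∑ y, (ρ x y + l * (ρ x z * ρ z y - (if y = z then ρ x z * O else 0) -
      (if x = z then I * ρ z y else 0))) = ∑ y, ρ x y - if x = z then l * O * I else 0 := by
    intro x
    rw [Finset.sum_add_distrib, ← Finset.mul_sum, Finset.sum_sub_distrib, Finset.sum_sub_distrib,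
      ← Finset.mul_sum, hOdef]
    by_cases hx : x = z
    · simp [hx, ← Finset.mul_sum, hOdef]
      ring
    · simp [hx]
  have hcol : ∀ y, ∑ x, (ρ x y + l * (ρ x z * ρ z y - (if y = z then ρ x z * O else 0) -
      (if x = z then I * ρ z y else 0))) = ∑ x, ρ x y - if y = z then l * O * I else 0 := by
    intro y
    rw [Finset.sum_add_distrib, ← Finset.mul_sum, Finset.sum_sub_distrib, Finset.sum_sub_distrib,
      ← Finset.sum_mul, hIdef]
    by_cases hy : y = z
    · simp [hy, ← Finset.sum_mul, hIdef]
      ring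
    · simp [hy]
  refine ⟨fun x y => ρ x y + l * (ρ x z * ρ z y - (if y = z then ρ x z * O else 0) -
    (if x = z then I * ρ z y else 0)), ?_, ?_, ?_, ?_, ?_⟩
  · intro x y
    dsimp only
    by_cases hx : x = z <;> by_cases hy : y = z
    · simp [hx, hy, hz]
    · simp only [hx, hy, hz, if_true, if_false]
      nlinarith [mul_nonneg (hρ z y) (sub_nonneg.2 hlI)]
    · simp only [hx, hy, hz, if_true, if_false]
      nlinarith [mul_nonneg (hρ x z) (sub_nonneg.2 hlO)]
    · simp only [hx, hy, if_false, sub_zero]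
      exact add_nonneg (hρ x y) (mul_nonneg hl0 (mul_nonneg (hρ x z) (hρ z y)))
  · intro x
    rw [← hdiv x, flowDiv, hrow, hcol, flowDiv]
    ring
  · have key : ∑ x, ∑ y, c x y * (ρ x z * ρ z y) ≤
        ∑ x, c x z * (ρ x z * O) + ∑ y, c z y * (I * ρ z y) := by
      calc ∑ x, ∑ y, c x y * (ρ x z * ρ z y)
          ≤ ∑ x, ∑ y, (c x z * ρ x z * ρ z y + ρ x z * (c z y * ρ z y)) := by
            refine Finset.sum_le_sum fun x _ => Finset.sum_le_sum fun y _ => ?_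
            nlinarith [mul_le_mul_of_nonneg_right (htri x z y) (mul_nonneg (hρ x z) (hρ z y))]
        _ = _ := by
            simp only [Finset.sum_add_distrib, ← Finset.mul_sum, ← Finset.sum_mul, hOdef, hIdef]
            congr 1
            · rw [Finset.sum_mul]
              exact Finset.sum_congr rfl fun x _ => by ring
            · rw [Finset.mul_sum]
              exact Finset.sum_congr rfl fun x _ => by ring
    have hexp : flowCost c (fun x y => ρ x y + l * (ρ x z * ρ z y -
        (if y = z then ρ x z * O else 0) - (if x = z then I * ρ z y else 0))) = flowCost c ρ +
        l * (∑ x, ∑ y, c x y * (ρ x z * ρ z y) - ∑ x, c x z * (ρ x z * O) -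
          ∑ y, c z y * (I * ρ z y)) := by
      have e1 : ∑ x, c x z * (ρ x z * O) = ∑ x, ∑ y, c x y * (if y = z then ρ x z * O else 0) := by
        simp
      have e2 : ∑ y, c z y * (I * ρ z y) = ∑ x, ∑ y, c x y * (if x = z then I * ρ z y else 0) := by
        rw [Finset.sum_comm]
        simp
      rw [e1, e2, flowCost, flowCost]
      simp only [← Finset.sum_sub_distrib, Finset.mul_sum, ← Finset.sum_add_distrib]
      exact Finset.sum_congr rfl fun x _ => Finset.sum_congr rfl fun y _ => by ring
    rw [hexp]
    nlinarith [mul_nonneg hl0 (sub_nonneg.2 key)]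
  · rw [hrow, hOdef, if_pos rfl, hlOI]
    linarith
  · intro x
    rw [hrow]
    have : 0 ≤ l * O * I := by positivity
    split_ifs <;> linarith

/-- A nonnegative flow with divergence `μ - ν` yields a transport plan from `μ` to `ν` of no larger
cost. -/
theorem exists_plan_of_flow (c : X → X → ℝ) (hc : ∀ x y, 0 ≤ c x y) (hc0 : ∀ x, c x x = 0)
    (htri : ∀ x y z, c x z ≤ c x y + c y z) {μ ν : X → ℝ} (hμ : ∀ x, 0 ≤ μ x) (hν : ∀ x, 0 ≤ ν x)
    (ρ : X → X → ℝ) (hρ : ∀ x y, 0 ≤ ρ x y) (hdiv : ∀ x, flowDiv ρ x = μ x - ν x) :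
    ∃ π : X → X → ℝ, (∀ x y, 0 ≤ π x y) ∧ (∀ x, ∑ y, π x y = μ x) ∧ (∀ y, ∑ x, π x y = ν y) ∧
      flowCost c π ≤ flowCost c ρ := by
  classical
  -- Rerouting at one vertex raises no other outflow, so vertices already treated stay within their
  -- bound.
  have step : ∀ T : Finset X, ∃ ρ' : X → X → ℝ, (∀ x y, 0 ≤ ρ' x y) ∧
      (∀ x, flowDiv ρ' x = μ x - ν x) ∧ flowCost c ρ' ≤ flowCost c ρ ∧
      ∀ x ∈ T, ∑ y, ρ' x y ≤ μ x := by
    intro T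
    induction T using Finset.induction_on with
    | empty => exact ⟨ρ, hρ, hdiv, le_rfl, by simp⟩
    | insert z T _ ih =>
      obtain ⟨ρ₁, h0, h1, h2, h3⟩ := ih
      obtain ⟨ρ₂, k0, k1, k2, k3, k4⟩ := exists_reroute_at c hc htri hμ hν ρ₁ h0 h1 z
      refine ⟨ρ₂, k0, k1, k2.trans h2, fun x hx => ?_⟩
      rcases Finset.mem_insert.1 hx with rfl | hx
      · exact k3
      · exact (k4 x).trans (h3 x hx)
  obtain ⟨ρ', h0, h1, h2, h3⟩ := step Finset.univ
  -- The mass of μ not yet shipped stays in place, at no cost; the divergence condition then makes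
  -- the column sums equal ν.
  refine ⟨fun x y => ρ' x y + if x = y then μ x - ∑ w, ρ' x w else 0, ?_, ?_, ?_, ?_⟩
  · intro x y
    dsimp only
    split_ifs
    · linarith [h0 x y, h3 x (Finset.mem_univ x)]
    · linarith [h0 x y]
  · intro x
    simp [Finset.sum_add_distrib]
  · intro y
    have := h1 y
    rw [flowDiv] at this
    simp [Finset.sum_add_distrib]
    linarith
  · refine le_trans (le_of_eq ?_) h2
    refine Finset.sum_congr rfl fun x _ => Finset.sum_congr rfl fun y _ => ?_
    dsimp only
    split_ifs with h
    · simp [h, hc0]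
    · simp

theorem flowDiv_add (ρ σ : X → X → ℝ) : flowDiv (ρ + σ) = flowDiv ρ + flowDiv σ := by
  ext x
  simp [flowDiv, Finset.sum_add_distrib]
  ring

theorem flowDiv_smul (a : ℝ) (ρ : X → X → ℝ) : flowDiv (a • ρ) = a • flowDiv ρ := by
  ext x
  simp [flowDiv, ← Finset.mul_sum, mul_sub]

theorem flowCost_add (c ρ σ : X → X → ℝ) : flowCost c (ρ + σ) = flowCost c ρ + flowCost c σ := by
  simp [flowCost, Finset.sum_add_distrib, mul_add]

theorem flowCost_smul (c : X → X → ℝ) (a : ℝ) (ρ : X → X → ℝ) :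
    flowCost c (a • ρ) = a * flowCost c ρ := by
  simp only [flowCost, Finset.mul_sum, Pi.smul_apply, smul_eq_mul]
  exact Finset.sum_congr rfl fun x _ => Finset.sum_congr rfl fun y _ => by ring

theorem flowCost_nonneg {c ρ : X → X → ℝ} (hc : ∀ x y, 0 ≤ c x y) (hρ : ∀ x y, 0 ≤ ρ x y) :
    0 ≤ flowCost c ρ :=
  Finset.sum_nonneg fun x _ => Finset.sum_nonneg fun y _ => mul_nonneg (hc x y) (hρ x y)

/-- The costs of the nonnegative flows with the divergence of `ρ`. -/
def flowCosts (c ρ : X → X → ℝ) : Set ℝ :=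
  {r | ∃ σ : X → X → ℝ, (∀ x y, 0 ≤ σ x y) ∧ flowDiv σ = flowDiv ρ ∧ flowCost c σ = r}

/-- Reversing the edges that carry negative flow makes a flow nonnegative without changing its
divergence. -/
theorem flowCosts_nonempty (c ρ : X → X → ℝ) : (flowCosts c ρ).Nonempty := by
  refine ⟨_, fun x y => max (ρ x y) 0 + max (-ρ y x) 0, fun x y => by positivity, ?_, rfl⟩
  ext x
  have h : ∀ a : ℝ, max a 0 - max (-a) 0 = a := fun a => by
    rcases le_total a 0 with h | h
    · rw [max_eq_right h, max_eq_left (by linarith)]; ring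
    · rw [max_eq_left h, max_eq_right (by linarith)]; ring
  simp only [flowDiv, ← Finset.sum_sub_distrib]
  refine Finset.sum_congr rfl fun y _ => ?_
  linarith [h (ρ x y), h (ρ y x)]

theorem flowCosts_bddBelow {c : X → X → ℝ} (hc : ∀ x y, 0 ≤ c x y) (ρ : X → X → ℝ) :
    BddBelow (flowCosts c ρ) := by
  refine ⟨0, ?_⟩
  rintro r ⟨σ, hσ, _, rfl⟩
  exact flowCost_nonneg hc hσ

/-- Duality for flows: some potential that is `1`-Lipschitz for `c` attains the infimal cost. -/
theorem exists_potential_eq_sInf_flowCosts {c : X → X → ℝ} (hc : ∀ x y, 0 ≤ c x y)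
    {μ ν : X → ℝ} (hμ1 : ∑ x, μ x = 1) (hν1 : ∑ x, ν x = 1) :
    ∃ f : X → ℝ, (∀ x y, f x - f y ≤ c x y) ∧
      ∑ x, f x * (μ x - ν x) = sInf (flowCosts c fun x y => μ x * ν y) := by
  classical
  obtain ⟨h0, hh0⟩ : ∃ h0 : X → X → ℝ, h0 = fun x y => μ x * ν y := ⟨_, rfl⟩
  -- `N` is sublinear and vanishes on divergence-free flows.
  obtain ⟨N, hN⟩ : ∃ N : (X → X → ℝ) → ℝ, N = fun ρ => sInf (flowCosts c ρ) := ⟨_, rfl⟩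
  have hNle : ∀ {ρ σ : X → X → ℝ}, (∀ x y, 0 ≤ σ x y) → flowDiv σ = flowDiv ρ →
      N ρ ≤ flowCost c σ := fun {ρ σ} h1 h2 => by
    rw [hN]; exact csInf_le (flowCosts_bddBelow hc ρ) ⟨σ, h1, h2, rfl⟩
  have hleN : ∀ {ρ : X → X → ℝ} {a : ℝ}, (∀ σ : X → X → ℝ, (∀ x y, 0 ≤ σ x y) →
      flowDiv σ = flowDiv ρ → a ≤ flowCost c σ) → a ≤ N ρ := fun {ρ a} h => by
    rw [hN]
    refine le_csInf (flowCosts_nonempty c ρ) ?_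
    rintro r ⟨σ, h1, h2, rfl⟩
    exact h σ h1 h2
  have hsmul_le : ∀ a : ℝ, 0 < a → ∀ ρ, N (a • ρ) ≤ a * N ρ := by
    intro a ha ρ
    rw [← div_le_iff₀' ha]
    refine hleN fun σ h1 h2 => ?_
    rw [div_le_iff₀' ha, ← flowCost_smul]
    exact hNle (fun x y => mul_nonneg ha.le (h1 x y)) (by rw [flowDiv_smul, flowDiv_smul, h2])
  have hsmul : ∀ a : ℝ, 0 < a → ∀ ρ, N (a • ρ) = a * N ρ := by
    intro a ha ρ
    refine le_antisymm (hsmul_le a ha ρ) ?_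
    have := hsmul_le a⁻¹ (inv_pos.2 ha) (a • ρ)
    rw [smul_smul, inv_mul_cancel₀ ha.ne', one_smul] at this
    rwa [← div_eq_inv_mul, le_div_iff₀' ha] at this
  have hadd : ∀ ρ σ, N (ρ + σ) ≤ N ρ + N σ := by
    intro ρ σ
    rw [← sub_le_iff_le_add]
    refine hleN fun ρ' h1 h2 => ?_
    rw [sub_le_comm]
    refine hleN fun σ' k1 k2 => ?_
    rw [sub_le_iff_le_add', ← flowCost_add]
    exact hNle (fun x y => add_nonneg (h1 x y) (k1 x y)) (by rw [flowDiv_add, flowDiv_add, h2, k2])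
  have hne : h0 ≠ 0 := by
    intro h
    have : ∑ x, ∑ y, h0 x y = 1 := by
      simp [hh0, ← Finset.mul_sum, hμ1, hν1]
    rw [h] at this
    simp at this
  have hzero : ∀ ρ, flowDiv ρ = 0 → N ρ = 0 := by
    intro ρ h
    refine le_antisymm ?_ (hleN fun σ h1 _ => flowCost_nonneg hc h1)
    refine (hNle (σ := 0) (fun _ _ => le_rfl) ?_).trans (by simp [flowCost])
    rw [h]; ext; simp [flowDiv]
  -- Hahn–Banach: a linear `L ≤ N` with equality at `h0`. It kills divergence-free flows, so it
  -- depends on the divergence alone and is given by a potential.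
  obtain ⟨L, hL1, hL2⟩ := exists_extension_of_le_sublinear
    (LinearPMap.mkSpanSingleton (K := ℝ) h0 (N h0) hne) N hsmul hadd (by
      rintro ⟨x, hx⟩
      obtain ⟨a, rfl⟩ := Submodule.mem_span_singleton.1 hx
      rw [LinearPMap.mkSpanSingleton'_apply]
      simp only [RingHom.id_apply, smul_eq_mul]
      rcases lt_trichotomy a 0 with ha | rfl | ha
      · have h1 := hsmul (-a) (by linarith) h0
        have h2 := hadd (a • h0) (-a • h0)
        rw [← add_smul, add_neg_cancel, zero_smul, hzero 0 (by ext; simp [flowDiv]), h1] at h2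
        linarith
      · rw [zero_smul, hzero 0 (by ext; simp [flowDiv])]; simp
      · exact (hsmul a ha h0).ge)
  have hL0 : ∀ ρ, flowDiv ρ = 0 → L ρ = 0 := by
    intro ρ h
    have h1 := hL2 ρ
    have h2 := hL2 (-ρ)
    rw [hzero ρ h] at h1
    rw [map_neg, hzero (-ρ)] at h2
    · linarith
    · rw [show -ρ = (-1 : ℝ) • ρ by simp, flowDiv_smul, h, smul_zero]
  have hLdiv : ∀ ρ σ, flowDiv ρ = flowDiv σ → L ρ = L σ := by
    intro ρ σ h
    have : L (ρ + (-1 : ℝ) • σ) = 0 := hL0 _ (by rw [flowDiv_add, flowDiv_smul, h]; simp)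
    rw [map_add, map_smul] at this
    simp at this
    linarith
  obtain ⟨e, he⟩ : ∃ e : X → X → X → X → ℝ,
      e = fun a b x y => if x = a ∧ y = b then 1 else 0 := ⟨_, rfl⟩
  have hediv : ∀ a b, flowDiv (e a b) = Pi.single a 1 - Pi.single b 1 := by
    intro a b
    ext x
    simp only [flowDiv, he, Pi.sub_apply, Pi.single_apply]
    congr 1
    · by_cases hx : x = a <;> simp [hx]
    · by_cases hx : x = b <;> simp [hx]
  obtain ⟨o⟩ : Nonempty X := by
    by_contra h
    rw [not_nonempty_iff] at h
    simp at hμ1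
  -- The unit flow a → b has the divergence of a → o minus b → o, so x ↦ L(e x o) is the potential,
  -- normalized at the base point `o`.
  have hLe : ∀ a b, L (e a b) = L (e a o) - L (e b o) := by
    intro a b
    rw [hLdiv (e a b) (e a o + (-1 : ℝ) • e b o)]
    · rw [map_add, map_smul]; simp; ring
    · rw [flowDiv_add, flowDiv_smul, hediv, hediv, hediv]
      ext x
      simp
  refine ⟨fun x => L (e x o), fun x y => ?_, ?_⟩
  · rw [← hLe]
    refine (hL2 _).trans ((hNle (σ := e x y) (fun a b => ?_) rfl).trans (le_of_eq ?_))
    · rw [he]; dsimp only; split_ifs <;> norm_num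
    · rw [flowCost, Finset.sum_eq_single x, Finset.sum_eq_single y]
      · simp [he]
      · intro b _ hb; simp [he, hb]
      · simp
      · intro b _ hb; simp [he, hb]
      · simp
  · have h1 : L h0 = N h0 := by
      have := hL1 ⟨h0, Submodule.mem_span_singleton_self h0⟩
      rw [LinearPMap.mkSpanSingleton_apply] at this
      exact this
    have h2 : h0 = ∑ a, ∑ b, (μ a * ν b) • e a b := by
      ext x y
      simp only [Finset.sum_apply, Pi.smul_apply, smul_eq_mul, he, hh0]
      rw [Finset.sum_eq_single x, Finset.sum_eq_single y]
      · simp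
      · intro b _ hb; simp [hb.symm]
      · simp
      · intro b _ hb; simp [hb.symm]
      · simp
    have h3 : N h0 = sInf (flowCosts c fun x y => μ x * ν y) := by rw [hN, hh0]
    rw [← h3, ← h1, h2]
    simp only [map_sum, map_smul, smul_eq_mul]
    simp only [mul_sub, Finset.sum_sub_distrib]
    have e1 : ∑ a, ∑ b, μ a * ν b * L (e a o) = ∑ x, L (e x o) * μ x := by
      refine Finset.sum_congr rfl fun a _ => ?_
      rw [← Finset.sum_mul, ← Finset.mul_sum, hν1]; ring
    have e2 : ∑ a, ∑ b, μ a * ν b * L (e b o) = ∑ x, L (e x o) * ν x := by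
      rw [Finset.sum_comm]
      refine Finset.sum_congr rfl fun a _ => ?_
      simp only [mul_assoc]
      rw [← Finset.sum_mul, hμ1]; ring
    rw [← e1, ← e2, ← Finset.sum_sub_distrib]
    refine Finset.sum_congr rfl fun a _ => ?_
    rw [← Finset.sum_sub_distrib]
    refine Finset.sum_congr rfl fun b _ => ?_
    rw [hLe a b]; ring

/-- Kantorovich duality on a finite space: some potential that is `1`-Lipschitz for `c` attains the
infimal cost of transport plans. -/
theorem exists_potential_forall_exists_plan (c : X → X → ℝ) (hc : ∀ x y, 0 ≤ c x y)
    (hc0 : ∀ x, c x x = 0) (htri : ∀ x y z, c x z ≤ c x y + c y z) {μ ν : X → ℝ}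
    (hμ : ∀ x, 0 ≤ μ x) (hν : ∀ x, 0 ≤ ν x) (hμ1 : ∑ x, μ x = 1) (hν1 : ∑ x, ν x = 1) :
    ∃ f : X → ℝ, (∀ x y, f x - f y ≤ c x y) ∧ ∀ ε > 0, ∃ π : X → X → ℝ, (∀ x y, 0 ≤ π x y) ∧
      (∀ x, ∑ y, π x y = μ x) ∧ (∀ y, ∑ x, π x y = ν y) ∧
      flowCost c π < ∑ x, f x * (μ x - ν x) + ε := by
  obtain ⟨f, hf, hfe⟩ := exists_potential_eq_sInf_flowCosts hc hμ1 hν1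
  refine ⟨f, hf, fun ε hε => ?_⟩
  rw [hfe]
  obtain ⟨_, ⟨ρ, hρ, hdiv, rfl⟩, hlt⟩ :=
    Real.lt_sInf_add_pos (flowCosts_nonempty c fun x y => μ x * ν y) hε
  obtain ⟨π, h0, h1, h2, h3⟩ := exists_plan_of_flow c hc hc0 htri hμ hν ρ hρ (fun x => by
    rw [hdiv]
    simp [flowDiv, ← Finset.mul_sum, ← Finset.sum_mul, hμ1, hν1])
  exact ⟨π, h0, h1, h2, h3.trans_lt hlt⟩

end FiniteTransport

/-! ### Kantorovich duality for finitely supported measures on a graph -/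

section Duality

variable {V : Type*}

/-- `f` is `1`-Lipschitz on `S` for the graph distance. -/
def IsPotential (G : SimpleGraph V) (S : Finset V) (f : V → ℝ) : Prop :=
  ∀ x ∈ S, ∀ y ∈ S, f x - f y ≤ G.dist x y

theorem edist_toENNReal {G : SimpleGraph V} {x y : V} (h : G.Reachable x y) :
    (G.edist x y : ℝ≥0∞) = ENNReal.ofReal (G.dist x y) := by
  rw [← h.coe_dist_eq_edist]
  simp

theorem IsTransportPlan.eq_zero_left {μ ν : V → ℝ} {π : V → V → ℝ} (h : IsTransportPlan μ ν π)
    {x : V} (hx : μ x = 0) (y : V) : π x y = 0 := by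
  have h1 := h.2.1 x
  rw [hx, hasSum_zero_iff_of_nonneg fun y => (h.1 x y).1] at h1
  exact congrFun h1 y

theorem IsTransportPlan.eq_zero_right {μ ν : V → ℝ} {π : V → V → ℝ} (h : IsTransportPlan μ ν π)
    {y : V} (hy : ν y = 0) (x : V) : π x y = 0 := by
  have h1 := h.2.2 y
  rw [hy, hasSum_zero_iff_of_nonneg fun x => (h.1 x y).1] at h1
  exact congrFun h1 x

variable {G : SimpleGraph V} {S : Finset V} {μ ν : V → ℝ}

/-- The cost of a plan bounds from above the integral of every potential. -/
theorem IsTransportPlan.ofReal_sum_le_transportCost {π : V → V → ℝ} (h : IsTransportPlan μ ν π)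
    (hreach : ∀ x ∈ S, ∀ y ∈ S, G.Reachable x y) (hμS : ∀ x ∉ S, μ x = 0) (hνS : ∀ x ∉ S, ν x = 0)
    {f : V → ℝ} (hf : IsPotential G S f) :
    ENNReal.ofReal (∑ x ∈ S, f x * (μ x - ν x)) ≤ transportCost G π := by
  have hrow : ∀ x, ∑ y ∈ S, π x y = μ x := fun x =>
    (hasSum_sum_of_ne_finset_zero fun y hy => h.eq_zero_right (hνS y hy) x).unique (h.2.1 x)
  have hcol : ∀ y, ∑ x ∈ S, π x y = ν y := fun y =>
    (hasSum_sum_of_ne_finset_zero fun x hx => h.eq_zero_left (hμS x hx) y).unique (h.2.2 y)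
  have h1 : ∑ x ∈ S, f x * (μ x - ν x) = ∑ x ∈ S, ∑ y ∈ S, (f x - f y) * π x y := by
    simp only [sub_mul, mul_sub, Finset.sum_sub_distrib]
    congr 1
    · exact Finset.sum_congr rfl fun x _ => by rw [← Finset.mul_sum, hrow]
    · rw [Finset.sum_comm]
      exact Finset.sum_congr rfl fun x _ => by rw [← Finset.mul_sum, hcol]
  calc ENNReal.ofReal (∑ x ∈ S, f x * (μ x - ν x))
      ≤ ENNReal.ofReal (∑ x ∈ S, ∑ y ∈ S, (G.dist x y : ℝ) * π x y) := by
        rw [h1]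
        exact ENNReal.ofReal_le_ofReal (Finset.sum_le_sum fun x hx => Finset.sum_le_sum fun y hy =>
          mul_le_mul_of_nonneg_right (hf x hx y hy) (h.1 x y).1)
    _ = ∑ x ∈ S, ∑ y ∈ S, (G.edist x y : ℝ≥0∞) * ENNReal.ofReal (π x y) := by
        have hnn : ∀ x y, 0 ≤ (G.dist x y : ℝ) * π x y := fun x y =>
          mul_nonneg (Nat.cast_nonneg _) (h.1 x y).1
        rw [ENNReal.ofReal_sum_of_nonneg fun x _ => Finset.sum_nonneg fun y _ => hnn x y]
        refine Finset.sum_congr rfl fun x hx => ?_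
        rw [ENNReal.ofReal_sum_of_nonneg fun y _ => hnn x y]
        refine Finset.sum_congr rfl fun y hy => ?_
        rw [ENNReal.ofReal_mul (Nat.cast_nonneg _), edist_toENNReal (hreach x hx y hy)]
    _ ≤ ∑ x ∈ S, ∑' y, (G.edist x y : ℝ≥0∞) * ENNReal.ofReal (π x y) :=
        Finset.sum_le_sum fun x _ => ENNReal.sum_le_tsum S
    _ ≤ transportCost G π := ENNReal.sum_le_tsum S

/-- A transport plan on a finite set bounds the Wasserstein distance. -/
theorem wasserstein_le_of_finite_plan
    (hreach : ∀ x ∈ S, ∀ y ∈ S, G.Reachable x y) (hμS : ∀ x ∉ S, μ x = 0) (hνS : ∀ x ∉ S, ν x = 0)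
    (hμ : ∀ x, μ x ≤ 1) (π : S → S → ℝ) (hπ : ∀ x y, 0 ≤ π x y) (hrow : ∀ x, ∑ y, π x y = μ x)
    (hcol : ∀ y, ∑ x, π x y = ν y) :
    wasserstein G μ ν ≤ ENNReal.ofReal (flowCost (fun x y : S => (G.dist x y : ℝ)) π) := by
  classical
  obtain ⟨σ, hσ⟩ : ∃ σ : V → V → ℝ,
      σ = fun x y => if h : x ∈ S ∧ y ∈ S then π ⟨x, h.1⟩ ⟨y, h.2⟩ else 0 := ⟨_, rfl⟩
  have hσS : ∀ x y : S, σ x y = π x y := fun x y => by rw [hσ]; simp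
  have hσl : ∀ x ∉ S, ∀ y, σ x y = 0 := fun x hx y => by rw [hσ]; simp [hx]
  have hσr : ∀ y ∉ S, ∀ x, σ x y = 0 := fun y hy x => by rw [hσ]; simp [hy]
  have hσ0 : ∀ x y, 0 ≤ σ x y := fun x y => by
    rw [hσ]; dsimp only; split_ifs
    · exact hπ _ _
    · exact le_rfl
  have hσrow : ∀ x, ∑ y ∈ S, σ x y = μ x := by
    intro x
    by_cases hx : x ∈ S
    · rw [← Finset.sum_coe_sort, ← hrow ⟨x, hx⟩]
      exact Finset.sum_congr rfl fun y _ => hσS ⟨x, hx⟩ y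
    · rw [hμS x hx]
      exact Finset.sum_eq_zero fun y _ => hσl x hx y
  have hσcol : ∀ y, ∑ x ∈ S, σ x y = ν y := by
    intro y
    by_cases hy : y ∈ S
    · rw [← Finset.sum_coe_sort, ← hcol ⟨y, hy⟩]
      exact Finset.sum_congr rfl fun x _ => hσS x ⟨y, hy⟩
    · rw [hνS y hy]
      exact Finset.sum_eq_zero fun x _ => hσr y hy x
  have hplan : IsTransportPlan μ ν σ := by
    refine ⟨fun x y => ⟨hσ0 x y, ?_⟩, fun x => ?_, fun y => ?_⟩
    · by_cases hy : y ∈ S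
      · exact (Finset.single_le_sum (fun y _ => hσ0 x y) hy).trans ((hσrow x).trans_le (hμ x))
      · rw [hσr y hy]; exact zero_le_one
    · rw [← hσrow x]
      exact hasSum_sum_of_ne_finset_zero fun y hy => hσr y hy x
    · rw [← hσcol y]
      exact hasSum_sum_of_ne_finset_zero fun x hx => hσl x hx y
  refine (iInf₂_le σ hplan).trans (le_of_eq ?_)
  rw [transportCost, tsum_eq_sum (s := S) fun x hx => by simp [hσl x hx]]
  have hnn : ∀ x y : S, 0 ≤ (G.dist x y : ℝ) * π x y := fun x y =>
    mul_nonneg (Nat.cast_nonneg _) (hπ x y)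
  rw [flowCost, ENNReal.ofReal_sum_of_nonneg fun x _ => Finset.sum_nonneg fun y _ => hnn x y,
    ← Finset.sum_coe_sort]
  refine Finset.sum_congr rfl fun x _ => ?_
  rw [tsum_eq_sum (s := S) fun y hy => by simp [hσr y hy],
    ENNReal.ofReal_sum_of_nonneg fun y _ => hnn x y, ← Finset.sum_coe_sort]
  refine Finset.sum_congr rfl fun y _ => ?_
  rw [ENNReal.ofReal_mul (Nat.cast_nonneg _), edist_toENNReal (hreach x x.2 y y.2), hσS]

/-- Kantorovich duality for finitely supported probability measures on a graph. -/
theorem isGreatest_wasserstein (hreach : ∀ x ∈ S, ∀ y ∈ S, G.Reachable x y)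
    (hμS : ∀ x ∉ S, μ x = 0) (hνS : ∀ x ∉ S, ν x = 0) (hμ : ∀ x, 0 ≤ μ x) (hν : ∀ x, 0 ≤ ν x)
    (hμ1 : ∑ x ∈ S, μ x = 1) (hν1 : ∑ x ∈ S, ν x = 1) :
    IsGreatest {r | ∃ f, IsPotential G S f ∧ r = ∑ x ∈ S, f x * (μ x - ν x)}
      (wasserstein G μ ν).toReal := by
  classical
  have hμle : ∀ x, μ x ≤ 1 := fun x => by
    by_cases hx : x ∈ S
    · exact (Finset.single_le_sum (fun y _ => hμ y) hx).trans_eq hμ1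
    · rw [hμS x hx]; exact zero_le_one
  obtain ⟨f, hf, hplan⟩ := exists_potential_forall_exists_plan
    (fun x y : S => (G.dist x y : ℝ)) (fun _ _ => Nat.cast_nonneg _) (by simp)
    (fun x y z => by
      rw [← Nat.cast_add, Nat.cast_le]
      exact (hreach x x.2 y y.2).dist_triangle_left z)
    (μ := fun x => μ x) (ν := fun x => ν x) (fun x => hμ x) (fun x => hν x)
    (by rw [Finset.sum_coe_sort, hμ1]) (by rw [Finset.sum_coe_sort, hν1])
  have hsum : ∑ x : S, f x * (μ x - ν x) =
      ∑ x ∈ S, (if h : x ∈ S then f ⟨x, h⟩ else 0) * (μ x - ν x) := by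
    rw [← Finset.sum_coe_sort S]
    exact Finset.sum_congr rfl fun x _ => by simp
  have hpot : IsPotential G S fun x => if h : x ∈ S then f ⟨x, h⟩ else 0 := by
    intro x hx y hy
    simpa [hx, hy] using hf ⟨x, hx⟩ ⟨y, hy⟩
  have hle : ∀ ε > 0, wasserstein G μ ν ≤ ENNReal.ofReal (∑ x : S, f x * (μ x - ν x) + ε) := by
    intro ε hε
    obtain ⟨π, h0, h1, h2, h3⟩ := hplan ε hε
    exact (wasserstein_le_of_finite_plan hreach hμS hνS hμle π h0 h1 h2).trans
      (ENNReal.ofReal_le_ofReal h3.le)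
  -- Finiteness matters because `toReal` sends `⊤` to 0.
  have htop : wasserstein G μ ν ≠ ⊤ := ne_top_of_le_ne_top ENNReal.ofReal_ne_top (hle 1 one_pos)
  have hub : ∀ {g : V → ℝ}, IsPotential G S g →
      ∑ x ∈ S, g x * (μ x - ν x) ≤ (wasserstein G μ ν).toReal := fun {g} hg =>
    (ENNReal.ofReal_le_iff_le_toReal htop).1
      (le_iInf₂ fun π hπ => hπ.ofReal_sum_le_transportCost hreach hμS hνS hg)
  have hnonneg : 0 ≤ ∑ x : S, f x * (μ x - ν x) := by
    refine le_of_forall_pos_le_add fun ε hε => ?_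
    obtain ⟨π, h0, h1, h2, h3⟩ := hplan ε hε
    exact (flowCost_nonneg (fun _ _ => Nat.cast_nonneg _) h0).trans h3.le
  refine ⟨⟨_, hpot, le_antisymm ?_ (hub hpot)⟩, ?_⟩
  · rw [← hsum]
    refine le_of_forall_pos_le_add fun ε hε => ?_
    exact ENNReal.toReal_le_of_le_ofReal (by linarith) (hle ε hε)
  · rintro r ⟨g, hg, rfl⟩
    exact hub hg

end Duality

/-! ### Curvature of an edge as a linear maximization over potentials -/

section Edge

variable {V : Type*}

/-- The closed neighbourhood as a finset. -/
noncomputable def closedNbhdFinset (G : SimpleGraph V) [G.LocallyFinite] (x : V) : Finset V :=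
  (finite_closedNbhd G x).toFinset

/-- The union of the closed neighbourhoods of two vertices. -/
noncomputable def edgeSupport (G : SimpleGraph V) [G.LocallyFinite] (x y : V) : Finset V :=
  ((finite_closedNbhd G x).union (finite_closedNbhd G y)).toFinset

/-- The difference of the sums of `f` over the closed neighbourhoods of `x` and `y`. -/
noncomputable def nbhdDiff (G : SimpleGraph V) [G.LocallyFinite] (x y : V) (f : V → ℝ) : ℝ :=
  ∑ v ∈ closedNbhdFinset G x, f v - ∑ v ∈ closedNbhdFinset G y, f v

/-- The values on potentials of the functional `s (f x - f y) + ∑_{N[x]} f - ∑_{N[y]} f`, to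
which the integral against a difference of lazy measures is proportional. -/
def edgeValues (G : SimpleGraph V) [G.LocallyFinite] (x y : V) (s : ℝ) : Set ℝ :=
  {r | ∃ f, IsPotential G (edgeSupport G x y) f ∧ r = s * (f x - f y) + nbhdDiff G x y f}

variable {G : SimpleGraph V} [G.LocallyFinite] {x y v : V}

theorem mem_closedNbhdFinset : v ∈ closedNbhdFinset G x ↔ v = x ∨ G.Adj x v := by
  simp [closedNbhdFinset, closedNbhd]

theorem mem_closedNbhdFinset_self : x ∈ closedNbhdFinset G x := mem_closedNbhdFinset.2 (Or.inl rfl)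

theorem mem_edgeSupport :
    v ∈ edgeSupport G x y ↔ v ∈ closedNbhdFinset G x ∨ v ∈ closedNbhdFinset G y := by
  simp [edgeSupport, closedNbhdFinset]

theorem card_closedNbhdFinset : (closedNbhdFinset G x).card = G.degree x + 1 := by
  classical
  have : closedNbhdFinset G x = insert x (G.neighborFinset x) := by
    ext v; simp [mem_closedNbhdFinset]
  rw [this, Finset.card_insert_of_notMem (by simp), SimpleGraph.card_neighborFinset_eq_degree]

theorem reachable_of_mem_closedNbhdFinset (h : v ∈ closedNbhdFinset G x) : G.Reachable x v := by
  rcases mem_closedNbhdFinset.1 h with rfl | h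
  · exact .rfl
  · exact h.reachable

theorem reachable_of_mem_edgeSupport (hxy : G.Adj x y) (h : v ∈ edgeSupport G x y) :
    G.Reachable x v := by
  rcases mem_edgeSupport.1 h with h | h
  · exact reachable_of_mem_closedNbhdFinset h
  · exact hxy.reachable.trans (reachable_of_mem_closedNbhdFinset h)

theorem reachable_of_mem_edgeSupport₂ (hxy : G.Adj x y) {u : V} (hu : u ∈ edgeSupport G x y)
    (hv : v ∈ edgeSupport G x y) : G.Reachable u v :=
  (reachable_of_mem_edgeSupport hxy hu).symm.trans (reachable_of_mem_edgeSupport hxy hv)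

theorem left_mem_edgeSupport : x ∈ edgeSupport G x y :=
  mem_edgeSupport.2 (Or.inl mem_closedNbhdFinset_self)

theorem right_mem_edgeSupport : y ∈ edgeSupport G x y :=
  mem_edgeSupport.2 (Or.inr mem_closedNbhdFinset_self)

-- Spreading the neighbour mass over the whole closed neighbourhood, with a correction at `x`,
-- brings in closed neighbourhoods, which are the sets that multiply in a strong product.
open Classical in
theorem lazyMeasure_eq (α : ℝ) (x v : V) : lazyMeasure G α x v =
    (if v = x then α - (1 - α) / G.degree x else 0) +
      if v ∈ closedNbhdFinset G x then (1 - α) / G.degree x else 0 := by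
  by_cases h : v = x
  · subst h
    simp [lazyMeasure, mem_closedNbhdFinset_self]
  · simp [lazyMeasure, h, mem_closedNbhdFinset]

theorem sum_mul_lazyMeasure (α : ℝ) {S : Finset V} (hS : closedNbhdFinset G x ⊆ S) (f : V → ℝ) :
    ∑ v ∈ S, f v * lazyMeasure G α x v = (α - (1 - α) / G.degree x) * f x +
      (1 - α) / G.degree x * ∑ v ∈ closedNbhdFinset G x, f v := by
  classical
  simp only [lazyMeasure_eq, mul_add, Finset.sum_add_distrib, mul_ite, mul_zero]
  rw [Finset.sum_ite_eq' S x, if_pos (hS mem_closedNbhdFinset_self), ← Finset.sum_filter,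
    Finset.filter_mem_eq_inter, Finset.inter_eq_right.2 hS, ← Finset.sum_mul]
  ring

theorem lazyMeasure_nonneg {α : ℝ} (h0 : 0 ≤ α) (h1 : α ≤ 1) (x v : V) :
    0 ≤ lazyMeasure G α x v := by
  rw [lazyMeasure]
  split_ifs
  · exact h0
  · exact div_nonneg (by linarith) (Nat.cast_nonneg _)
  · exact le_rfl

theorem lazyMeasure_eq_zero (α : ℝ) (h : v ∉ closedNbhdFinset G x) : lazyMeasure G α x v = 0 := by
  rw [mem_closedNbhdFinset] at h
  push Not at h
  simp [lazyMeasure, h]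

theorem sum_lazyMeasure (α : ℝ) {S : Finset V} (hS : closedNbhdFinset G x ⊆ S)
    (hd : G.degree x ≠ 0) : ∑ v ∈ S, lazyMeasure G α x v = 1 := by
  have := sum_mul_lazyMeasure α hS fun _ => 1
  simp only [one_mul, mul_one] at this
  rw [this, Finset.sum_const, card_closedNbhdFinset]
  have : (G.degree x : ℝ) ≠ 0 := Nat.cast_ne_zero.2 hd
  simp
  field_simp
  ring

theorem isGreatest_wasserstein_lazyMeasure {d : ℕ} (hxy : G.Adj x y) (hx : G.degree x = d)
    (hy : G.degree y = d) {α : ℝ} (h0 : 0 ≤ α) (h1 : α ≤ 1) :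
    IsGreatest {r | ∃ f, IsPotential G (edgeSupport G x y) f ∧
        r = (α - (1 - α) / d) * (f x - f y) + (1 - α) / d * nbhdDiff G x y f}
      (wasserstein G (lazyMeasure G α x) (lazyMeasure G α y)).toReal := by
  have hSx : closedNbhdFinset G x ⊆ edgeSupport G x y := fun v hv => mem_edgeSupport.2 (Or.inl hv)
  have hSy : closedNbhdFinset G y ⊆ edgeSupport G x y := fun v hv => mem_edgeSupport.2 (Or.inr hv)
  have hdx : G.degree x ≠ 0 :=
    ((G.degree_pos_iff_exists_adj x).2 ⟨y, hxy⟩).ne'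
  have hdy : G.degree y ≠ 0 :=
    ((G.degree_pos_iff_exists_adj y).2 ⟨x, hxy.symm⟩).ne'
  convert isGreatest_wasserstein (fun u hu v hv => reachable_of_mem_edgeSupport₂ hxy hu hv)
    (fun v hv => lazyMeasure_eq_zero α fun h => hv (hSx h))
    (fun v hv => lazyMeasure_eq_zero α fun h => hv (hSy h))
    (lazyMeasure_nonneg h0 h1 x) (lazyMeasure_nonneg h0 h1 y) (sum_lazyMeasure α hSx hdx)
    (sum_lazyMeasure α hSy hdy) using 5 with r f
  simp only [mul_sub, Finset.sum_sub_distrib]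
  rw [sum_mul_lazyMeasure α hSx, sum_mul_lazyMeasure α hSy, hx, hy, nbhdDiff]
  constructor <;> (rintro ⟨h, rfl⟩; exact ⟨h, by ring⟩)

/-- The Wasserstein distance between lazy measures in terms of `edgeValues`. -/
theorem isGreatest_edgeValues {d : ℕ} (hxy : G.Adj x y) (hx : G.degree x = d)
    (hy : G.degree y = d) {α : ℝ} (h0 : 0 ≤ α) (h1 : α < 1) :
    IsGreatest (edgeValues G x y (α * d / (1 - α) - 1))
      (d / (1 - α) * (wasserstein G (lazyMeasure G α x) (lazyMeasure G α y)).toReal) := by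
  have hd : (0 : ℝ) < d := by
    rw [Nat.cast_pos, ← hx]
    exact (G.degree_pos_iff_exists_adj x).2 ⟨y, hxy⟩
  have h1' : 0 < 1 - α := by linarith
  obtain ⟨⟨f, hf, hfe⟩, hub⟩ := isGreatest_wasserstein_lazyMeasure hxy hx hy h0 h1.le
  refine ⟨⟨f, hf, ?_⟩, ?_⟩
  · rw [hfe]
    field_simp
  · rintro r ⟨g, hg, rfl⟩
    have := mul_le_mul_of_nonneg_left (hub ⟨g, hg, rfl⟩) (div_nonneg hd.le h1'.le)
    refine le_trans (le_of_eq ?_) this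
    field_simp

/-- Every s ≥ −1 is the parameter of an idleness in [0, 1), namely α = (1 + s)/(d + 1 + s), and
duality is attained there. -/
theorem exists_isGreatest_edgeValues {d : ℕ} (hxy : G.Adj x y) (hx : G.degree x = d)
    (hy : G.degree y = d) {s : ℝ} (hs : -1 ≤ s) : ∃ m, IsGreatest (edgeValues G x y s) m := by
  have hd : (0 : ℝ) < d := by
    rw [Nat.cast_pos, ← hx]
    exact (G.degree_pos_iff_exists_adj x).2 ⟨y, hxy⟩
  have hs' : 0 < d + 1 + s := by linarith
  have h := isGreatest_edgeValues hxy hx hy (α := (1 + s) / (d + 1 + s))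
    (div_nonneg (by linarith) hs'.le) (by rw [div_lt_one hs']; linarith)
  have e : (1 + s) / (d + 1 + s) * d / (1 - (1 + s) / (d + 1 + s)) - 1 = s := by
    have : 1 - (1 + s) / (d + 1 + s) = d / (d + 1 + s) := by field_simp; ring
    rw [this]
    field_simp
    ring
  rw [e] at h
  exact ⟨_, h⟩

end Edge

theorem exists_between_finset_images {ι : Type*} {A B : Finset ι} {p q : ι → ℝ}
    (h : ∀ a ∈ A, ∀ b ∈ B, p a ≤ q b) : ∃ c, (∀ a ∈ A, p a ≤ c) ∧ ∀ b ∈ B, c ≤ q b := by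
  rcases A.eq_empty_or_nonempty with rfl | hA
  · rcases B.eq_empty_or_nonempty with rfl | hB
    · exact ⟨0, by simp, by simp⟩
    · obtain ⟨b, _, hb'⟩ := B.exists_min_image q hB
      exact ⟨q b, by simp, hb'⟩
  · obtain ⟨a, ha, ha'⟩ := A.exists_max_image p hA
    exact ⟨p a, ha', h a ha⟩

/-! ### Clamping potentials: the maximum for nonnegative parameters -/

section Potentials

variable {V : Type*} {G : SimpleGraph V} [G.LocallyFinite] {x y : V}

/-- Equal degrees make the shift by `c` cancel, and common vertices of the two closed neighbourhoods
cancel too, so only the exclusive ones need comparing. -/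
theorem nbhdDiff_le_nbhdDiff (hdeg : G.degree x = G.degree y) {f g : V → ℝ} (c : ℝ)
    (hx : ∀ v ∈ closedNbhdFinset G x, v ∉ closedNbhdFinset G y → f v - c ≤ g v)
    (hy : ∀ v ∈ closedNbhdFinset G y, v ∉ closedNbhdFinset G x → g v ≤ f v - c) :
    nbhdDiff G x y f ≤ nbhdDiff G x y g := by
  classical
  have hcard : ((closedNbhdFinset G x).card : ℝ) = (closedNbhdFinset G y).card := by
    rw [card_closedNbhdFinset, card_closedNbhdFinset, hdeg]
  have h : nbhdDiff G x y f = ∑ v ∈ closedNbhdFinset G x, (f v - c) -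
      ∑ v ∈ closedNbhdFinset G y, (f v - c) := by
    simp [nbhdDiff, Finset.sum_sub_distrib, hcard]
  rw [h, nbhdDiff, ← Finset.sum_sdiff_sub_sum_sdiff,
    ← Finset.sum_sdiff_sub_sum_sdiff (f := g)]
  refine sub_le_sub (Finset.sum_le_sum fun v hv => ?_) (Finset.sum_le_sum fun v hv => ?_)
  · rw [Finset.mem_sdiff] at hv
    exact hx v hv.1 hv.2
  · rw [Finset.mem_sdiff] at hv
    exact hy v hv.1 hv.2

/-- A vertex outside the closed neighbourhood of `y` has distance at least two from `y`. -/
theorem two_le_dist {v : V} (hr : G.Reachable v y) (hv : v ∉ closedNbhdFinset G y) :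
    2 ≤ G.dist v y := by
  rw [mem_closedNbhdFinset] at hv
  push Not at hv
  have h0 : G.dist v y ≠ 0 := SimpleGraph.dist_ne_zero_iff_ne_and_reachable.2 ⟨hv.1, hr⟩
  have h1 : G.dist v y ≠ 1 := fun h => hv.2 (SimpleGraph.dist_eq_one_iff_adj.1 h).symm
  omega

theorem dist_le_one_of_mem_closedNbhdFinset {v : V} (hv : v ∈ closedNbhdFinset G x) :
    G.dist v x ≤ 1 := by
  rcases mem_closedNbhdFinset.1 hv with rfl | h
  · simp
  · exact (SimpleGraph.dist_eq_one_iff_adj.2 h.symm).le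

theorem cast_dist_triangle {G : SimpleGraph V} {u v w : V} (h : G.Reachable u v) :
    (G.dist u w : ℝ) ≤ G.dist u v + G.dist v w := by
  rw [← Nat.cast_add, Nat.cast_le]
  exact h.dist_triangle_left w

/-- Every potential can be replaced by one that drops by `1` from `x` to `y` without lowering
`nbhdDiff`. -/
theorem IsPotential.exists_drop_eq_one (hxy : G.Adj x y) (hdeg : G.degree x = G.degree y)
    {f : V → ℝ} (hf : IsPotential G (edgeSupport G x y) f) :
    ∃ g, IsPotential G (edgeSupport G x y) g ∧ g x - g y = 1 ∧
      nbhdDiff G x y f ≤ nbhdDiff G x y g := by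
  classical
  have hd : (G.dist x y : ℝ) = 1 := by rw [SimpleGraph.dist_eq_one_iff_adj.2 hxy, Nat.cast_one]
  have hreach : ∀ {u v}, u ∈ edgeSupport G x y → v ∈ edgeSupport G x y → G.Reachable u v :=
    fun hu hv => reachable_of_mem_edgeSupport₂ hxy hu hv
  have hxS : x ∈ edgeSupport G x y := left_mem_edgeSupport
  have hyS : y ∈ edgeSupport G x y := right_mem_edgeSupport
  -- The shift is to give f − c ≤ 2 on N[x] and f − c ≥ −1 on N[y]. It exists because points of N[x]
  -- and N[y] are at distance at most 3.
  obtain ⟨c, hcA, hcB⟩ := exists_between_finset_images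
    (A := closedNbhdFinset G x) (B := closedNbhdFinset G y)
    (p := fun v => f v - 2) (q := fun v => f v + 1) (by
      intro a ha b hb
      have haS := mem_edgeSupport.2 (Or.inl ha : a ∈ _ ∨ a ∈ closedNbhdFinset G y)
      have hbS := mem_edgeSupport.2 (Or.inr hb : b ∈ closedNbhdFinset G x ∨ b ∈ _)
      have h1 := hf a haS b hbS
      have h2 := cast_dist_triangle (w := b) (hreach haS hxS)
      have h3 := cast_dist_triangle (w := b) (hreach hxS hyS)
      have h4 : (G.dist a x : ℝ) ≤ 1 := by exact_mod_cast dist_le_one_of_mem_closedNbhdFinset ha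
      have h5 : (G.dist y b : ℝ) ≤ 1 := by
        rw [SimpleGraph.dist_comm]; exact_mod_cast dist_le_one_of_mem_closedNbhdFinset hb
      linarith)
  -- The two clamps force the values 1 at `x` and 0 at `y`. On N[x] \ N[y] the upper clamp is at
  -- least 2, and on N[y] \ N[x] the lower one is at most −1, so neither lowers `nbhdDiff`.
  refine ⟨fun v => max (1 - G.dist v x) (min (G.dist v y) (f v - c)), ?_, ?_, ?_⟩
  · intro u hu v hv
    dsimp only
    have h1 := cast_dist_triangle (w := x) (hreach hv hu)
    have h2 := cast_dist_triangle (w := y) (hreach hu hv)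
    rw [SimpleGraph.dist_comm (u := v) (v := u)] at h1
    rw [sub_le_iff_le_add', ← max_add_add_right, ← min_add_add_right]
    exact max_le_max (by linarith) (min_le_min (by linarith) (by linarith [hf u hu v hv]))
  · dsimp only
    rw [SimpleGraph.dist_self, SimpleGraph.dist_self, SimpleGraph.dist_comm (u := y), hd,
      max_eq_left (by simp), max_eq_left (by simp)]
    simp
  · refine nbhdDiff_le_nbhdDiff hdeg c (fun v hv hv' => ?_) (fun v hv hv' => ?_)
    · have h2 : (2 : ℝ) ≤ G.dist v y := by
        exact_mod_cast two_le_dist (hreach (mem_edgeSupport.2 (Or.inl hv)) hyS) hv'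
      refine le_max_of_le_right (le_min ?_ le_rfl)
      linarith [hcA v hv]
    · have h2 : (2 : ℝ) ≤ G.dist v x := by
        exact_mod_cast two_le_dist (hreach (mem_edgeSupport.2 (Or.inr hv)) hxS) hv'
      refine max_le ?_ (min_le_right _ _)
      linarith [hcB v hv]

theorem IsPotential.drop_le_one (hxy : G.Adj x y) {f : V → ℝ}
    (hf : IsPotential G (edgeSupport G x y) f) : f x - f y ≤ 1 := by
  have := hf x left_mem_edgeSupport y right_mem_edgeSupport
  rwa [SimpleGraph.dist_eq_one_iff_adj.2 hxy, Nat.cast_one] at this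

/-- The maximum of `edgeValues` is affine with slope one on `[0, ∞)`. -/
theorem isGreatest_edgeValues_of_nonneg (hxy : G.Adj x y) (hdeg : G.degree x = G.degree y) {m s : ℝ}
    (h : IsGreatest (edgeValues G x y 0) m) (hs : 0 ≤ s) :
    IsGreatest (edgeValues G x y s) (s + m) := by
  obtain ⟨⟨f, hf, hfe⟩, hub⟩ := h
  obtain ⟨g, hg, hg1, hfg⟩ := hf.exists_drop_eq_one hxy hdeg
  have hgm : nbhdDiff G x y g ≤ m := hub ⟨g, hg, by ring⟩
  refine ⟨⟨g, hg, ?_⟩, ?_⟩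
  · rw [hg1]; linarith
  · rintro r ⟨k, hk, rfl⟩
    have hkm : nbhdDiff G x y k ≤ m := hub ⟨k, hk, by ring⟩
    nlinarith [hk.drop_le_one hxy]

end Potentials

/-! ### Integer-valued optimal potentials and affinity on [−1, 0] -/

section Integrality

open MeasureTheory

theorem floor_add_ae_eq (a : ℝ) :
    (fun t : ℝ => (⌊a + t⌋ : ℝ)) =ᵐ[volume.restrict (Set.Ico 0 1)]
      fun t => (⌊a⌋ : ℝ) + (Set.Ici (1 - Int.fract a)).indicator 1 t := by
  filter_upwards [ae_restrict_mem measurableSet_Ico] with t ht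
  have h1 : a + t = ⌊a⌋ + (Int.fract a + t) := by rw [← add_assoc, Int.floor_add_fract]
  rw [h1, Int.floor_intCast_add, Int.cast_add]
  congr 1
  have h2 := Int.fract_nonneg a
  have h3 := Int.fract_lt_one a
  by_cases h : 1 - Int.fract a ≤ t
  · have : ⌊Int.fract a + t⌋ = 1 := Int.floor_eq_iff.2 ⟨by push_cast; linarith, by
      push_cast; linarith [ht.2]⟩
    simp [this, h]
  · have : ⌊Int.fract a + t⌋ = 0 := Int.floor_eq_iff.2 ⟨by push_cast; linarith [ht.1], by
      push_cast; linarith⟩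
    simp [this, h]

theorem integrable_floor_add (a : ℝ) :
    Integrable (fun t : ℝ => (⌊a + t⌋ : ℝ)) (volume.restrict (Set.Ico 0 1)) := by
  refine Integrable.congr ?_ (floor_add_ae_eq a).symm
  exact (integrable_const _).add ((integrable_const (1 : ℝ)).indicator measurableSet_Ici)

/-- Rounding after a uniformly random shift is unbiased, so it preserves linear functionals on
average. -/
theorem integral_floor_add (a : ℝ) : ∫ t in Set.Ico (0 : ℝ) 1, (⌊a + t⌋ : ℝ) = a := by
  have hi : Integrable ((Set.Ici (1 - Int.fract a)).indicator (1 : ℝ → ℝ))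
      (volume.restrict (Set.Ico 0 1)) := (integrable_const (1 : ℝ)).indicator measurableSet_Ici
  rw [integral_congr_ae (floor_add_ae_eq a), integral_add (integrable_const _) hi,
    integral_indicator_one measurableSet_Ici]
  have h3 := Int.fract_lt_one a
  have h : Set.Ici (1 - Int.fract a) ∩ Set.Ico 0 1 = Set.Ico (1 - Int.fract a) 1 := by
    ext t
    simp only [Set.mem_inter_iff, Set.mem_Ici, Set.mem_Ico]
    constructor
    · rintro ⟨h1, h2⟩; exact ⟨h1, h2.2⟩
    · rintro ⟨h1, h2⟩; exact ⟨h1, by linarith, h2⟩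
  rw [measureReal_restrict_apply measurableSet_Ici, h, Real.volume_real_Ico_of_le
    (by linarith [Int.fract_nonneg a])]
  simp

variable {V : Type*} {G : SimpleGraph V} [G.LocallyFinite] {x y : V}

/-- Graph distances are integers, so they pass through the floor. -/
theorem IsPotential.floor_add {G : SimpleGraph V} {S : Finset V} {f : V → ℝ} (hf : IsPotential G S f) (t : ℝ) :
    IsPotential G S fun v => (⌊f v + t⌋ : ℝ) := by
  intro u hu v hv
  have h : ⌊f u + t⌋ ≤ ⌊f v + t⌋ + (G.dist u v : ℤ) := by
    rw [← Int.floor_add_natCast]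
    exact Int.floor_le_floor (by linarith [hf u hu v hv])
  have h' : (⌊f u + t⌋ : ℝ) ≤ ⌊f v + t⌋ + (G.dist u v : ℝ) := by exact_mod_cast h
  linarith

/-- The maximum of `edgeValues` is attained at an integer-valued potential. -/
theorem exists_int_potential {s m : ℝ} (h : IsGreatest (edgeValues G x y s) m) :
    ∃ f : V → ℤ, IsPotential G (edgeSupport G x y) (fun v => (f v : ℝ)) ∧
      m = s * ((f x : ℝ) - f y) + nbhdDiff G x y fun v => (f v : ℝ) := by
  obtain ⟨⟨f, hf, hfe⟩, hub⟩ := h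
  have hint : ∫ t in Set.Ico (0 : ℝ) 1, (s * ((⌊f x + t⌋ : ℝ) - ⌊f y + t⌋) +
      nbhdDiff G x y fun v => (⌊f v + t⌋ : ℝ)) = m := by
    have i1 : Integrable (fun t : ℝ => s * ((⌊f x + t⌋ : ℝ) - ⌊f y + t⌋))
        (volume.restrict (Set.Ico 0 1)) :=
      ((integrable_floor_add _).sub (integrable_floor_add _)).const_mul s
    have i2 : ∀ T : Finset V, Integrable (fun t : ℝ => ∑ v ∈ T, (⌊f v + t⌋ : ℝ))
        (volume.restrict (Set.Ico 0 1)) :=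
      fun T => integrable_finsetSum _ fun v _ => integrable_floor_add _
    have i3 : Integrable (fun t : ℝ => nbhdDiff G x y fun v => (⌊f v + t⌋ : ℝ))
        (volume.restrict (Set.Ico 0 1)) := (i2 _).sub (i2 _)
    rw [integral_add i1 i3]
    simp only [nbhdDiff]
    rw [integral_sub (i2 _) (i2 _), integral_const_mul,
      integral_sub (integrable_floor_add _) (integrable_floor_add _),
      integral_finsetSum _ fun v _ => integrable_floor_add _,
      integral_finsetSum _ fun v _ => integrable_floor_add _]
    simp only [integral_floor_add]
    exact hfe.symm
  have : IsProbabilityMeasure (volume.restrict (Set.Ico (0 : ℝ) 1)) := ⟨by simp⟩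
  have hintg : Integrable (fun t : ℝ => s * ((⌊f x + t⌋ : ℝ) - ⌊f y + t⌋) +
      nbhdDiff G x y fun v => (⌊f v + t⌋ : ℝ)) (volume.restrict (Set.Ico 0 1)) :=
    (((integrable_floor_add _).sub (integrable_floor_add _)).const_mul s).add
      ((integrable_finsetSum _ fun v _ => integrable_floor_add _).sub
        (integrable_finsetSum _ fun v _ => integrable_floor_add _))
  -- The rounded potentials have average value `m`, so some shift reaches at least the maximum.
  obtain ⟨t, ht⟩ := exists_integral_le hintg
  rw [hint] at ht
  exact ⟨fun v => ⌊f v + t⌋, hf.floor_add t, le_antisymm ht (hub ⟨_, hf.floor_add t, rfl⟩)⟩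

theorem nbhdDiff_intCast (f : V → ℤ) : nbhdDiff G x y (fun v => (f v : ℝ)) =
    ((∑ v ∈ closedNbhdFinset G x, f v - ∑ v ∈ closedNbhdFinset G y, f v : ℤ) : ℝ) := by
  simp [nbhdDiff]

theorem isPotential_intCast_iff {G : SimpleGraph V} {S : Finset V} {f : V → ℤ} :
    IsPotential G S (fun v => (f v : ℝ)) ↔ ∀ u ∈ S, ∀ v ∈ S, f u - f v ≤ G.dist u v := by
  simp only [IsPotential]
  norm_cast

/-- One integer-valued potential attains the maximum of `edgeValues` at both `0` and `-1`. -/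
theorem exists_common_maximizer (hxy : G.Adj x y) (hdeg : G.degree x = G.degree y) {m₀ m₁ : ℝ}
    (h₀ : IsGreatest (edgeValues G x y 0) m₀) (h₁ : IsGreatest (edgeValues G x y (-1)) m₁) :
    ∃ f, IsPotential G (edgeSupport G x y) f ∧ nbhdDiff G x y f = m₀ ∧
      nbhdDiff G x y f - (f x - f y) = m₁ := by
  obtain ⟨D, hD⟩ : ∃ D : (V → ℤ) → ℤ,
      D = fun f => ∑ v ∈ closedNbhdFinset G x, f v - ∑ v ∈ closedNbhdFinset G y, f v := ⟨_, rfl⟩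
  have hDcast : ∀ f : V → ℤ, nbhdDiff G x y (fun v => (f v : ℝ)) = (D f : ℝ) := fun f => by
    rw [hD, nbhdDiff_intCast]
  -- The parameter 1 replaces 0 here: attaining 1 + m₀ forces both drop 1 and D f = m₀.
  obtain ⟨f, hf, hfe⟩ := exists_int_potential (isGreatest_edgeValues_of_nonneg hxy hdeg h₀ zero_le_one)
  obtain ⟨g, hg, hge⟩ := exists_int_potential h₁
  have hub₀ : ∀ k : V → ℤ, IsPotential G (edgeSupport G x y) (fun v => (k v : ℝ)) →
      (D k : ℝ) ≤ m₀ := fun k hk => h₀.2 ⟨_, hk, by rw [hDcast]; ring⟩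
  have hub₁ : ∀ k : V → ℤ, IsPotential G (edgeSupport G x y) (fun v => (k v : ℝ)) →
      (D k : ℝ) - (k x - k y) ≤ m₁ := fun k hk => h₁.2 ⟨_, hk, by rw [hDcast]; ring⟩
  rw [hDcast] at hfe hge
  have hf1 : (f x : ℝ) - f y = 1 := by
    have := hf.drop_le_one hxy
    linarith [hub₀ f hf]
  have hm₀ : m₀ = (D f : ℝ) := by linarith
  have hm₁ : m₁ = ((D g - (g x - g y) : ℤ) : ℝ) := by push_cast; linarith
  suffices ∃ k : V → ℤ, IsPotential G (edgeSupport G x y) (fun v => (k v : ℝ)) ∧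
      D k = D f ∧ D k - (k x - k y) = D g - (g x - g y) by
    obtain ⟨k, hk, h1, h2⟩ := this
    refine ⟨fun v => (k v : ℝ), hk, ?_, ?_⟩
    · rw [hDcast, hm₀, h1]
    · rw [hDcast, hm₁, ← h2]
      push_cast
      ring
  rw [hm₀] at hub₀
  rw [hm₁] at hub₁
  have hub₀' : ∀ k : V → ℤ, IsPotential G (edgeSupport G x y) (fun v => (k v : ℝ)) →
      D k ≤ D f := fun k hk => by exact_mod_cast hub₀ k hk
  have hub₁' : ∀ k : V → ℤ, IsPotential G (edgeSupport G x y) (fun v => (k v : ℝ)) →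
      D k - (k x - k y) ≤ D g - (g x - g y) := fun k hk => by exact_mod_cast hub₁ k hk
  have hfxy : f x - f y = 1 := by exact_mod_cast hf1
  have hlip : ∀ k : V → ℤ, IsPotential G (edgeSupport G x y) (fun v => (k v : ℝ)) →
      k x - k y ≤ 1 ∧ k y - k x ≤ 1 := fun k hk => by
    have h1 := isPotential_intCast_iff.1 hk x left_mem_edgeSupport y right_mem_edgeSupport
    have h2 := isPotential_intCast_iff.1 hk y right_mem_edgeSupport x left_mem_edgeSupport
    rw [SimpleGraph.dist_eq_one_iff_adj.2 hxy] at h1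
    rw [SimpleGraph.dist_eq_one_iff_adj.2 hxy.symm] at h2
    exact ⟨by simpa using h1, by simpa using h2⟩
  -- The midpoint of `f` and `g`, rounded down and up, gives two potentials with D p + D q = D f + D
  -- g.
  obtain ⟨p, hp⟩ : ∃ p : V → ℤ, p = fun v => (f v + g v) / 2 := ⟨_, rfl⟩
  obtain ⟨q, hq⟩ : ∃ q : V → ℤ, q = fun v => (f v + g v + 1) / 2 := ⟨_, rfl⟩
  have hpq : ∀ v, p v + q v = f v + g v := fun v => by rw [hp, hq]; dsimp only; omega
  have hDpq : D p + D q = D f + D g := by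
    rw [hD]
    dsimp only
    have : ∀ T : Finset V, ∑ v ∈ T, p v + ∑ v ∈ T, q v = ∑ v ∈ T, f v + ∑ v ∈ T, g v := fun T => by
      rw [← Finset.sum_add_distrib, ← Finset.sum_add_distrib]
      exact Finset.sum_congr rfl fun v _ => hpq v
    linarith [this (closedNbhdFinset G x), this (closedNbhdFinset G y)]
  have hf' := isPotential_intCast_iff.1 hf
  have hg' := isPotential_intCast_iff.1 hg
  have hpP : IsPotential G (edgeSupport G x y) (fun v => (p v : ℝ)) :=
    isPotential_intCast_iff.2 fun u hu v hv => by
      have h1 := hf' u hu v hv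
      have h2 := hg' u hu v hv
      rw [hp]; dsimp only; omega
  have hqP : IsPotential G (edgeSupport G x y) (fun v => (q v : ℝ)) :=
    isPotential_intCast_iff.2 fun u hu v hv => by
      have h1 := hf' u hu v hv
      have h2 := hg' u hu v hv
      rw [hq]; dsimp only; omega
  have hpx : p x = (f x + g x) / 2 := by rw [hp]
  have hpy : p y = (f y + g y) / 2 := by rw [hp]
  have hpqx := hpq x
  have hpqy := hpq y
  have f1 := hub₁' f hf
  have g0 := hub₀' g hg
  have p0 := hub₀' p hpP
  have p1 := hub₁' p hpP
  have q0 := hub₀' q hqP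
  have q1 := hub₁' q hqP
  have hgl := hlip g hg
  -- If neither `g` nor `f` serves, then `g` has drop −1 and D g = D f − 1. So `p` and `q` have drop
  -- 0 and D p + D q = 2 D f − 1, and the one with D equal to D f is optimal for both parameters.
  by_cases c1 : D g = D f
  · exact ⟨g, hg, c1, rfl⟩
  by_cases c2 : D f - (f x - f y) = D g - (g x - g y)
  · exact ⟨f, hf, rfl, c2⟩
  by_cases c3 : D p = D f
  · exact ⟨p, hpP, c3, by omega⟩
  · exact ⟨q, hqP, by omega, by omega⟩

/-- The maximum of `edgeValues` is affine on `[-1, 0]`. -/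
theorem isGreatest_edgeValues_neg (hxy : G.Adj x y) (hdeg : G.degree x = G.degree y) {m₀ m₁ t : ℝ}
    (h₀ : IsGreatest (edgeValues G x y 0) m₀) (h₁ : IsGreatest (edgeValues G x y (-1)) m₁)
    (ht0 : 0 ≤ t) (ht1 : t ≤ 1) :
    IsGreatest (edgeValues G x y (-t)) ((1 - t) * m₀ + t * m₁) := by
  obtain ⟨f, hf, hf0, hf1⟩ := exists_common_maximizer hxy hdeg h₀ h₁
  refine ⟨⟨f, hf, ?_⟩, ?_⟩
  · rw [← hf1, ← hf0]; ring
  · rintro r ⟨g, hg, rfl⟩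
    have g0 := h₀.2 ⟨g, hg, rfl⟩
    have g1 := h₁.2 ⟨g, hg, rfl⟩
    nlinarith [mul_le_mul_of_nonneg_left g0 (sub_nonneg.2 ht1), mul_le_mul_of_nonneg_left g1 ht0]

end Integrality

/-! ### Curvatures in terms of the maximum -/

section Curvature

variable {V : Type*} {G : SimpleGraph V} [G.LocallyFinite] {x y : V} {d : ℕ}

theorem HasLLYCurv.llyCurv_eq {κ : ℝ} (h : HasLLYCurv G x y κ) : llyCurv G x y = κ := by
  have hex : ∃ κ, HasLLYCurv G x y κ := ⟨κ, h⟩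
  rw [llyCurv, dif_pos hex]
  exact tendsto_nhds_unique hex.choose_spec h

theorem ricciCurv_eq (hxy : G.Adj x y) (hx : G.degree x = d) (hy : G.degree y = d) {α m : ℝ}
    (h0 : 0 ≤ α) (h1 : α < 1) (hm : IsGreatest (edgeValues G x y (α * d / (1 - α) - 1)) m) :
    ricciCurv G α x y = 1 - (1 - α) * m / d := by
  have hd : (0 : ℝ) < d := by
    rw [Nat.cast_pos, ← hx]
    exact (G.degree_pos_iff_exists_adj x).2 ⟨y, hxy⟩
  have h1' : 0 < 1 - α := by linarith
  rw [ricciCurv, SimpleGraph.dist_eq_one_iff_adj.2 hxy, Nat.cast_one, div_one,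
    hm.unique (isGreatest_edgeValues hxy hx hy h0 h1)]
  field_simp

/-- For α ≥ 1/(d + 1) the parameter is nonnegative, where the maximum is s + m; then κ_α/(1 − α) is
constant in α, so the limit is immediate. -/
theorem hasLLYCurv_of_isGreatest (hxy : G.Adj x y) (hx : G.degree x = d) (hy : G.degree y = d)
    {m : ℝ} (hm : IsGreatest (edgeValues G x y 0) m) : HasLLYCurv G x y (1 + (1 - m) / d) := by
  have hd : (0 : ℝ) < d := by
    rw [Nat.cast_pos, ← hx]
    exact (G.degree_pos_iff_exists_adj x).2 ⟨y, hxy⟩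
  refine Tendsto.congr' ?_ tendsto_const_nhds
  have hlt : 1 / ((d : ℝ) + 1) < 1 := by rw [div_lt_one] <;> linarith
  filter_upwards [Ioo_mem_nhdsLT hlt] with α hα
  have h1' : 0 < 1 - α := by linarith [hα.2]
  have h0 : 0 ≤ α := le_trans (by positivity) hα.1.le
  have hs : 0 ≤ α * d / (1 - α) - 1 := by
    rw [sub_nonneg, le_div_iff₀ h1']
    have := hα.1
    rw [div_lt_iff₀ (by linarith)] at this
    linarith
  rw [ricciCurv_eq hxy hx hy h0 hα.2
    (isGreatest_edgeValues_of_nonneg hxy (hx.trans hy.symm) hm hs)]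
  field_simp
  ring

end Curvature

/-! ### Strong products: distances, neighbourhoods and averaging over the fibre -/

section StrongProduct

variable {V W : Type*} {G : SimpleGraph V} {H : SimpleGraph W}

theorem exists_walk_strongProd (u : V) {v v' : W} (p : H.Walk v v') :
    ∃ q : (strongProd G H).Walk (u, v) (u, v'), q.length = p.length := by
  induction p with
  | nil => exact ⟨.nil, rfl⟩
  | @cons a b c hab p ih =>
    obtain ⟨q, hq⟩ := ih
    have hadj : (strongProd G H).Adj (u, a) (u, b) :=
      ⟨fun h => hab.ne (congrArg Prod.snd h), Or.inl rfl, Or.inr hab⟩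
    exact ⟨.cons hadj q, by simp [hq]⟩

/-- The first step in `H` can move the first coordinate from `u` to `u'` at no extra cost; this
needs at least one step, hence v ≠ v'. -/
theorem dist_strongProd_le {u u' : V} {v v' : W} (hu : u' ∈ closedNbhd G u) (hv : v ≠ v')
    (hr : H.Reachable v v') : (strongProd G H).dist (u, v) (u', v') ≤ H.dist v v' := by
  obtain ⟨p, hp⟩ := hr.exists_walk_length_eq_dist
  rw [← hp]
  cases p with
  | nil => exact absurd rfl hv
  | @cons _ b _ hab p =>
    obtain ⟨q, hq⟩ := exists_walk_strongProd (G := G) u' p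
    have hadj : (strongProd G H).Adj (u, v) (u', b) :=
      ⟨fun h => hab.ne (congrArg Prod.snd h), hu, Or.inr hab⟩
    refine (SimpleGraph.dist_le (.cons hadj q)).trans (le_of_eq ?_)
    simp [hq]

theorem exists_walk_snd {p q : V × W} (w : (strongProd G H).Walk p q) :
    ∃ w' : H.Walk p.2 q.2, w'.length ≤ w.length := by
  induction w with
  | nil => exact ⟨.nil, le_rfl⟩
  | @cons a b c hab w ih =>
    obtain ⟨w', hw'⟩ := ih
    rcases hab.2.2 with h | h
    · exact ⟨w'.copy h rfl, by simp; omega⟩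
    · exact ⟨.cons h w', Nat.succ_le_succ hw'⟩

theorem dist_snd_le {p q : V × W} (hr : (strongProd G H).Reachable p q) :
    H.dist p.2 q.2 ≤ (strongProd G H).dist p q := by
  obtain ⟨w, hw⟩ := hr.exists_walk_length_eq_dist
  obtain ⟨w', hw'⟩ := exists_walk_snd w
  exact (SimpleGraph.dist_le w').trans (hw'.trans hw.le)

theorem strongProd_adj_of_twins {x₁ x₂ : V} {y₁ y₂ : W}
    (hx : closedNbhd G x₁ = closedNbhd G x₂) (hy : H.Adj y₁ y₂) :
    (strongProd G H).Adj (x₁, y₁) (x₂, y₂) := by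
  refine ⟨fun h => hy.ne (congrArg Prod.snd h), ?_, Or.inr hy⟩
  change x₂ ∈ closedNbhd G x₁
  rw [hx]
  exact Or.inl rfl

variable [G.LocallyFinite] [H.LocallyFinite]

theorem closedNbhdFinset_strongProd (p : V × W) : closedNbhdFinset (strongProd G H) p =
    closedNbhdFinset G p.1 ×ˢ closedNbhdFinset H p.2 := by
  ext ⟨u, v⟩
  obtain ⟨x, y⟩ := p
  have hadj : (strongProd G H).Adj (x, y) (u, v) ↔
      (x, y) ≠ (u, v) ∧ (u = x ∨ G.Adj x u) ∧ (v = y ∨ H.Adj y v) := Iff.rfl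
  rw [Finset.mem_product, mem_closedNbhdFinset, mem_closedNbhdFinset, mem_closedNbhdFinset, hadj,
    Prod.mk.injEq, ne_eq, Prod.mk.injEq, eq_comm (a := x), eq_comm (a := y)]
  tauto

theorem degree_strongProd (p : V × W) : (strongProd G H).degree p =
    G.degree p.1 + H.degree p.2 + G.degree p.1 * H.degree p.2 := by
  have h := card_closedNbhdFinset (G := strongProd G H) (x := p)
  rw [closedNbhdFinset_strongProd, Finset.card_product, card_closedNbhdFinset,
    card_closedNbhdFinset] at h
  linarith

variable {x₁ x₂ : V} {y₁ y₂ : W}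

theorem mem_edgeSupport_strongProd (hx : closedNbhd G x₁ = closedNbhd G x₂) {p : V × W} :
    p ∈ edgeSupport (strongProd G H) (x₁, y₁) (x₂, y₂) ↔
      p.1 ∈ closedNbhdFinset G x₁ ∧ p.2 ∈ edgeSupport H y₁ y₂ := by
  have h : closedNbhdFinset G x₂ = closedNbhdFinset G x₁ := by simp only [closedNbhdFinset, hx]
  simp only [mem_edgeSupport, closedNbhdFinset_strongProd, Finset.mem_product, h]
  tauto

theorem nbhdDiff_strongProd (hx : closedNbhd G x₁ = closedNbhd G x₂) (f : V × W → ℝ) :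
    nbhdDiff (strongProd G H) (x₁, y₁) (x₂, y₂) f =
      nbhdDiff H y₁ y₂ fun v => ∑ u ∈ closedNbhdFinset G x₁, f (u, v) := by
  have h : closedNbhdFinset G x₂ = closedNbhdFinset G x₁ := by simp only [closedNbhdFinset, hx]
  simp only [nbhdDiff, closedNbhdFinset_strongProd, h, Finset.sum_product_right]

/-- `nbhdDiff` does not depend on the values at the two endpoints of an edge. -/
theorem nbhdDiff_congr (hy : H.Adj y₁ y₂) {f g : W → ℝ}
    (h : ∀ v, v ≠ y₁ → v ≠ y₂ → f v = g v) : nbhdDiff H y₁ y₂ f = nbhdDiff H y₁ y₂ g := by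
  classical
  have h1 : ∀ v ∈ closedNbhdFinset H y₁ \ closedNbhdFinset H y₂, f v = g v := fun v hv => by
    rw [Finset.mem_sdiff, mem_closedNbhdFinset, mem_closedNbhdFinset] at hv
    refine h v ?_ fun e => hv.2 (Or.inl e)
    rintro rfl
    exact hv.2 (Or.inr hy.symm)
  have h2 : ∀ v ∈ closedNbhdFinset H y₂ \ closedNbhdFinset H y₁, f v = g v := fun v hv => by
    rw [Finset.mem_sdiff, mem_closedNbhdFinset, mem_closedNbhdFinset] at hv
    refine h v (fun e => hv.2 (Or.inl e)) ?_
    rintro rfl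
    exact hv.2 (Or.inr hy)
  rw [nbhdDiff, nbhdDiff, ← Finset.sum_sdiff_sub_sum_sdiff,
    ← Finset.sum_sdiff_sub_sum_sdiff (f := g), Finset.sum_congr rfl h1, Finset.sum_congr rfl h2]

/-- Pulling back a potential on `H` gives a potential on the strong product. -/
theorem IsPotential.comp_snd (hx : closedNbhd G x₁ = closedNbhd G x₂) (hy : H.Adj y₁ y₂)
    {f : W → ℝ} (hf : IsPotential H (edgeSupport H y₁ y₂) f) :
    IsPotential (strongProd G H) (edgeSupport (strongProd G H) (x₁, y₁) (x₂, y₂))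
      fun p => f p.2 := by
  intro p hp q hq
  have hr := reachable_of_mem_edgeSupport₂ (strongProd_adj_of_twins hx hy) hp hq
  refine (hf _ ((mem_edgeSupport_strongProd hx).1 hp).2 _
    ((mem_edgeSupport_strongProd hx).1 hq).2).trans ?_
  exact_mod_cast dist_snd_le hr

open Classical in
/-- The function on `H` that averages `f` over the closed neighbourhood of `x₁`, except at `y₁`
and `y₂`, where it is the value of `f` at `(x₁, y₁)` and `(x₂, y₂)`. -/
noncomputable def fibreAverage (G : SimpleGraph V) [G.LocallyFinite] (x₁ x₂ : V) (y₁ y₂ : W)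
    (f : V × W → ℝ) (v : W) : ℝ :=
  if v = y₁ then f (x₁, y₁) else if v = y₂ then f (x₂, y₂) else
    (∑ u ∈ closedNbhdFinset G x₁, f (u, v)) / (closedNbhdFinset G x₁).card

theorem card_closedNbhdFinset_pos (x : V) : (0 : ℝ) < (closedNbhdFinset G x).card := by
  rw [card_closedNbhdFinset]
  positivity

theorem isPotential_fibreAverage (hx : closedNbhd G x₁ = closedNbhd G x₂) (hy : H.Adj y₁ y₂)
    {f : V × W → ℝ}
    (hf : IsPotential (strongProd G H) (edgeSupport (strongProd G H) (x₁, y₁) (x₂, y₂)) f) :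
    IsPotential H (edgeSupport H y₁ y₂) (fibreAverage G x₁ x₂ y₁ y₂ f) := by
  classical
  have hk := card_closedNbhdFinset_pos (G := G) x₁
  have hN : ∀ u, u ∈ closedNbhdFinset G x₁ ↔ u ∈ closedNbhd G x₁ := fun u => by
    simp [closedNbhdFinset]
  have hx₁ : x₁ ∈ closedNbhdFinset G x₁ := mem_closedNbhdFinset_self
  have hx₂ : x₂ ∈ closedNbhdFinset G x₁ := by rw [hN, hx]; exact Or.inl rfl
  have hlip : ∀ {u u' : V} {v v' : W}, u ∈ closedNbhdFinset G x₁ → u' ∈ closedNbhdFinset G x₁ →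
      v ∈ edgeSupport H y₁ y₂ → v' ∈ edgeSupport H y₁ y₂ → v ≠ v' → u' ∈ closedNbhd G u →
      f (u, v) ≤ H.dist v v' + f (u', v') := fun {u u' v v'} hu hu' hv hv' hne huu' => by
    have h1 := hf (u, v) ((mem_edgeSupport_strongProd hx).2 ⟨hu, hv⟩) (u', v')
      ((mem_edgeSupport_strongProd hx).2 ⟨hu', hv'⟩)
    have h2 : ((strongProd G H).dist (u, v) (u', v') : ℝ) ≤ H.dist v v' := by
      exact_mod_cast dist_strongProd_le huu' hne (reachable_of_mem_edgeSupport₂ hy hv hv')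
    linarith
  have hsymm : ∀ {u u' : V}, u' ∈ closedNbhd G u → u ∈ closedNbhd G u' := fun {u u'} h => by
    rcases h with h | h
    · exact Or.inl h.symm
    · exact Or.inr (G.adj_symm h)
  have hy₁ : y₁ ∈ edgeSupport H y₁ y₂ := left_mem_edgeSupport
  have hy₂ : y₂ ∈ edgeSupport H y₁ y₂ := right_mem_edgeSupport
  -- comparison of the value at a point whose fibre neighbours are all of `N[x₁]` with an average
  have hcmp : ∀ {x : V} {v v' : W}, x ∈ closedNbhdFinset G x₁ →
      (∀ u ∈ closedNbhdFinset G x₁, u ∈ closedNbhd G x) → v ∈ edgeSupport H y₁ y₂ →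
      v' ∈ edgeSupport H y₁ y₂ → v ≠ v' →
      f (x, v) - (∑ u ∈ closedNbhdFinset G x₁, f (u, v')) / (closedNbhdFinset G x₁).card ≤
        H.dist v v' ∧
      (∑ u ∈ closedNbhdFinset G x₁, f (u, v')) / (closedNbhdFinset G x₁).card - f (x, v) ≤
        H.dist v' v := by
    intro x v v' hxN hux hv hv' hne
    constructor
    · rw [sub_le_comm, le_div_iff₀ hk, mul_comm, ← nsmul_eq_mul]
      exact Finset.card_nsmul_le_sum _ _ _ fun u hu => by
        linarith [hlip hxN hu hv hv' hne (hux u hu)]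
    · rw [sub_le_iff_le_add, div_le_iff₀ hk, mul_comm, ← nsmul_eq_mul]
      exact Finset.sum_le_card_nsmul _ _ _ fun u hu =>
        hlip hu hxN hv' hv hne.symm (hsymm (hux u hu))
  -- The closed twins `x₁` and `x₂` see the whole fibre, so the point values used at `y₁` and `y₂`
  -- can be compared with averages.
  have hux₁ : ∀ u ∈ closedNbhdFinset G x₁, u ∈ closedNbhd G x₁ := fun u hu => (hN u).1 hu
  have hux₂ : ∀ u ∈ closedNbhdFinset G x₁, u ∈ closedNbhd G x₂ := fun u hu => hx ▸ (hN u).1 hu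
  intro v hv v' hv'
  by_cases hvv : v = v'
  · simp [hvv]
  by_cases h1 : v = y₁
  · subst h1
    by_cases h2 : v' = y₂
    · subst h2
      simp only [fibreAverage, if_true, hy.ne', if_false]
      linarith [hlip hx₁ hx₂ hv hv' hvv (hux₁ _ hx₂)]
    · simp only [fibreAverage, if_true, Ne.symm hvv, h2, if_false]
      exact (hcmp hx₁ hux₁ hv hv' hvv).1
  · by_cases h2 : v = y₂
    · subst h2
      by_cases h3 : v' = y₁
      · subst h3
        simp only [fibreAverage, if_true, hy.ne', if_false]
        linarith [hlip hx₂ hx₁ hv hv' hvv (hux₂ _ hx₁)]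
      · simp only [fibreAverage, if_true, h1, h3, Ne.symm hvv, if_false]
        exact (hcmp hx₂ hux₂ hv hv' hvv).1
    · by_cases h3 : v' = y₁
      · subst h3
        simp only [fibreAverage, if_true, h1, h2, if_false]
        exact (hcmp hx₁ hux₁ hv' hv (Ne.symm hvv)).2
      · by_cases h4 : v' = y₂
        · subst h4
          simp only [fibreAverage, if_true, h1, h3, hvv, if_false]
          exact (hcmp hx₂ hux₂ hv' hv (Ne.symm hvv)).2
        · simp only [fibreAverage, h1, h2, h3, h4, if_false]
          -- Two averages are compared along equal first coordinates, since two vertices of N[x₁]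
          -- need not be adjacent.
          rw [← sub_div, ← Finset.sum_sub_distrib, div_le_iff₀ hk, mul_comm, ← nsmul_eq_mul]
          exact Finset.sum_le_card_nsmul _ _ _ fun u hu => by
            linarith [hlip hu hu hv hv' hvv (Or.inl rfl)]

/-- The maximum of `edgeValues` for an edge of the strong product over closed twins. -/
theorem isGreatest_edgeValues_strongProd (hx : closedNbhd G x₁ = closedNbhd G x₂)
    (hy : H.Adj y₁ y₂) {s m : ℝ} (hm : IsGreatest (edgeValues H y₁ y₂ s) m) :
    IsGreatest (edgeValues (strongProd G H) (x₁, y₁) (x₂, y₂) ((G.degree x₁ + 1) * s))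
      ((G.degree x₁ + 1) * m) := by
  have hcard : ((closedNbhdFinset G x₁).card : ℝ) = G.degree x₁ + 1 := by
    rw [card_closedNbhdFinset]; push_cast; rfl
  have hk : (0 : ℝ) < G.degree x₁ + 1 := by positivity
  have hmul : ∀ g : W → ℝ, nbhdDiff H y₁ y₂ (fun v => (G.degree x₁ + 1) * g v) =
      (G.degree x₁ + 1) * nbhdDiff H y₁ y₂ g := fun g => by
    simp only [nbhdDiff, ← Finset.mul_sum, mul_sub]
  obtain ⟨⟨f, hf, hfe⟩, hub⟩ := hm
  refine ⟨⟨_, hf.comp_snd hx hy, ?_⟩, ?_⟩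
  · rw [nbhdDiff_strongProd hx]
    simp only [Finset.sum_const, nsmul_eq_mul]
    rw [hcard, hmul, hfe]
    ring
  · rintro r ⟨F, hF, rfl⟩
    have h := hub ⟨_, isPotential_fibreAverage hx hy hF, rfl⟩
    have e : nbhdDiff (strongProd G H) (x₁, y₁) (x₂, y₂) F =
        (G.degree x₁ + 1) * nbhdDiff H y₁ y₂ (fibreAverage G x₁ x₂ y₁ y₂ F) := by
      rw [nbhdDiff_strongProd hx, ← hmul]
      -- At `y₁` and `y₂` the fibre average is not an average, but `nbhdDiff` ignores those two
      -- values.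
      refine nbhdDiff_congr hy fun v h1 h2 => ?_
      rw [fibreAverage, if_neg h1, if_neg h2, hcard]
      field_simp
    have e1 : fibreAverage G x₁ x₂ y₁ y₂ F y₁ = F (x₁, y₁) := by simp [fibreAverage]
    have e2 : fibreAverage G x₁ x₂ y₁ y₂ F y₂ = F (x₂, y₂) := by simp [fibreAverage, hy.ne']
    rw [e1, e2] at h
    rw [e, mul_assoc, ← mul_add]
    exact mul_le_mul_of_nonneg_left h hk.le

end StrongProduct

end RicciGraph

/-! ### The curvature formulas -/

theorem theorem2 {V W : Type*} (G : SimpleGraph V) (H : SimpleGraph W)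
    [G.LocallyFinite] [H.LocallyFinite] (dG dH : ℕ)
    (hG : G.IsRegularOfDegree dG) (hH : H.IsRegularOfDegree dH)
    (x₁ x₂ : V) (hx : RicciGraph.closedNbhd G x₁ = RicciGraph.closedNbhd G x₂)
    (y₁ y₂ : W) (hy : H.Adj y₁ y₂) :
    -- the vertex degree of the strong product
    (RicciGraph.strongProd G H).IsRegularOfDegree (dG + dH + dG * dH) ∧
    -- the two limits that define the Lin–Lu–Yau curvatures exist
    RicciGraph.HasLLYCurv H y₁ y₂ (RicciGraph.llyCurv H y₁ y₂) ∧
    RicciGraph.HasLLYCurv (RicciGraph.strongProd G H) (x₁, y₁) (x₂, y₂)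
      (RicciGraph.llyCurv (RicciGraph.strongProd G H) (x₁, y₁) (x₂, y₂)) ∧
    -- the two curvature formulas
    RicciGraph.llyCurv (RicciGraph.strongProd G H) (x₁, y₁) (x₂, y₂) =
      (dH : ℝ) * ((dG : ℝ) + 1) / ((dG : ℝ) + (dH : ℝ) + (dG : ℝ) * (dH : ℝ)) *
        RicciGraph.llyCurv H y₁ y₂ ∧
    RicciGraph.ricciCurv (RicciGraph.strongProd G H) 0 (x₁, y₁) (x₂, y₂) =
      (dG : ℝ) * (dH : ℝ) / ((dG : ℝ) + (dH : ℝ) + (dG : ℝ) * (dH : ℝ)) *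
          RicciGraph.llyCurv H y₁ y₂ +
        (dH : ℝ) / ((dG : ℝ) + (dH : ℝ) + (dG : ℝ) * (dH : ℝ)) *
          RicciGraph.ricciCurv H 0 y₁ y₂ := by
  have hdH : (0 : ℝ) < dH := by
    rw [Nat.cast_pos, ← hH y₁]
    exact (H.degree_pos_iff_exists_adj y₁).2 ⟨y₂, hy⟩
  have hdG : (0 : ℝ) ≤ dG := Nat.cast_nonneg _
  have hreg : (RicciGraph.strongProd G H).IsRegularOfDegree (dG + dH + dG * dH) := fun p => by
    rw [RicciGraph.degree_strongProd, hG p.1, hH p.2]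
  have hadj := RicciGraph.strongProd_adj_of_twins hx hy
  have hdeg : H.degree y₁ = H.degree y₂ := (hH y₁).trans (hH y₂).symm
  obtain ⟨m₀, hm₀⟩ := RicciGraph.exists_isGreatest_edgeValues hy (hH y₁) (hH y₂)
    (s := 0) (by norm_num)
  obtain ⟨m₁, hm₁⟩ := RicciGraph.exists_isGreatest_edgeValues hy (hH y₁) (hH y₂)
    (s := -1) le_rfl
  have hk : (0 : ℝ) < dG + 1 := by linarith
  have hD : (0 : ℝ) < dG + dH + dG * dH := by positivity
  have hp₀ := RicciGraph.isGreatest_edgeValues_strongProd hx hy hm₀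
  -- The parameter −1/(d_G + 1) in `H` scales to −1 in the product, which is idleness 0.
  have hp₁ := RicciGraph.isGreatest_edgeValues_strongProd hx hy
    (RicciGraph.isGreatest_edgeValues_neg hy hdeg hm₀ hm₁ (t := 1 / (dG + 1)) (by positivity)
      (by rw [div_le_one hk]; linarith))
  rw [hG x₁, mul_zero] at hp₀
  rw [hG x₁, mul_neg, mul_one_div_cancel hk.ne'] at hp₁
  have hH_lly := RicciGraph.hasLLYCurv_of_isGreatest hy (hH y₁) (hH y₂) hm₀
  have hP_lly := RicciGraph.hasLLYCurv_of_isGreatest hadj (hreg _) (hreg _) hp₀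
  have hH0 := RicciGraph.ricciCurv_eq hy (hH y₁) (hH y₂) (α := 0) le_rfl one_pos
    (m := m₁) (by simpa using hm₁)
  have hP0 := RicciGraph.ricciCurv_eq hadj (hreg _) (hreg _) (α := 0) le_rfl one_pos
    (m := _) (by simpa only [zero_mul, zero_div, zero_sub] using hp₁)
  refine ⟨hreg, ?_, ?_, ?_, ?_⟩
  · rwa [hH_lly.llyCurv_eq]
  · rwa [hP_lly.llyCurv_eq]
  · rw [hH_lly.llyCurv_eq, hP_lly.llyCurv_eq]
    push_cast
    field_simp
    ring
  · rw [hH_lly.llyCurv_eq, hP0, hH0]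
    push_cast
    field_simp
    ring
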